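/- **Setting.** Let $K\ge1$, $d\ge 0$, $T\ge2$ be integers, $\epsilon\in(0,1]$, $v>0$, $\delta\in(0,1)$. There are fixed contexts $x_{t,a}\in\mathbb R^d$ (round $t$, arm $a\in\{1,\dots,K\}$) and an unknown $\theta_*\in\mathbb R^d$ with $\|x_{t,a}\|\le1$, $\|\theta_*\|\le1$. The random payoffs $r_{t,a}$ satisfy $\mathrm E[r_{t,a}]=x_{t,a}^\top\theta_*$ and $\mathrm E[|r_{t,a}|^{1+\epsilon}]\le v$, and the payoff vectors $(r_{t,a})_{a}$ of different rounds $t$ are independent. In round $t$ the learner plays an arm $a_t$ and observes only $r_{t,a_t}$. Its regret is $R(T)=\sum_{t=1}^T\big(\max_a x_{t,a}^\top\theta_*-x_{t,a_t}^\top\theta_*\big)$. **Basic algorithm BTC.** In round $t$, for an index set $\Psi\subseteq\{1,\dots,t-1\}$, let $A=I_d+\sum_{\tau\in\Psi}x_{\tau,a_\tau}x_{\tau,a_\tau}^\top$, let $V$ be the matrix with rows $x_{\tau,a_\tau}^\top$, $\tau\in\Psi$, and $$\alpha_t=\Big(\tfrac23\ln\tfrac{2TK\ln T}{\delta}+\sqrt{2v\ln\tfrac{2TK\ln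 T}{\delta}}+v\Big)t^{\frac{1-\epsilon}{2(1+\epsilon)}} .$$ For an arm $a$ put $[\beta_\tau]_{\tau\in\Psi}=x_{t,a}^\top A^{-1}V^\top$ and $h=\big(\sum_{\tau\in\Psi}|\beta_\tau|^{1+\epsilon}\big)^{1/(1+\epsilon)}$. BTC returns the estimate $\hat r_{t,a}=\sum_{\tau\in\Psi}\beta_\tau r_{\tau,a_\tau}\mathbf 1_{|\beta_\tau r_{\tau,a_\tau}|\le h}$ and the width $w_{t,a}=(\alpha_t+1)\sqrt{x_{t,a}^\top A^{-1}x_{t,a}}$. **Master algorithm SupBTC.** Let $S=\lfloor\ln T\rfloor$ and start with $\Psi^s=\varnothing$ for all $s$. In each round $t=1,\dots,T$ start with $s=1$ and $\hat A_1=\{1,\dots,K\}$, and repeat until an arm is found: compute $\hat r^s_{t,a},w^s_{t,a}$ for $a\in\hat A_s$ by BTC with $\Psi^s$. 1. If $w^s_{t,a}\le1/\sqrt T$ for all $a\in\hat A_s$, play an $a_t\in\hat A_s$ that maximizes $\hat r^s_{t,a}+w^s_{t,a}$, and leave all index sets unchanged. 2. Otherwise, if $w^s_{t,a}>2^{-s}$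 for some $a\in\hat A_s$, play such an arm $a_t$; if $s\le S$, add $t$ to $\Psi^s$; leave the other index sets unchanged. 3. Otherwise put $\hat A_{s+1}=\{a\in\hat A_s:\hat r^s_{t,a}+w^s_{t,a}\ge\max_{a'\in\hat A_s}(\hat r^s_{t,a'}+w^s_{t,a'})-2^{1-s}\}$ and replace $s$ by $s+1$. Choices among several possible arms are made by an arbitrary fixed rule; the one in step 1 may depend on $t$, $s$ and the set of maximizers, the one in step 2 on $t$, $s$, the widths $w_{t,\cdot}^s$ and the set of arms of $\hat A_s$ with $w_{t,a}^s>2^{-s}$. **Theorem 2.** With probability at least $1-\delta$, the regret of SupBTC satisfies $$R(T)\le2\sqrt T+40\ln T\sqrt{dT}+40\Big(\tfrac23\ln\tfrac{2TK\ln T}{\delta}+\sqrt{2v\ln\tfrac{2TK\ln T}{\delta}}+v\Big)\ln T\,\sqrt d\,T^{\frac1{1+\epsilon}} .$$ -/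

import Mathlib

open MeasureTheory ProbabilityTheory
open scoped Matrix

namespace SupBTC

/-! The basic algorithm BTC (ridge regression with truncation).
`y τ` is the context of the arm that was played in round `τ`, `p τ` is the payoff that was observed
in round `τ`, `Ψ` is the index set handed over by the master algorithm and `z` is the context of the
arm whose payoff is to be estimated. -/

/-- `A = I + ∑_{τ ∈ Ψ} y_τ y_τᵀ`. -/
noncomputable def gram {d : ℕ} (y : ℕ → EuclideanSpace ℝ (Fin d)) (Ψ : Finset ℕ) :
    Matrix (Fin d) (Fin d) ℝ :=
  1 + ∑ τ ∈ Ψ, Matrix.vecMulVec (y τ).ofLp (y τ).ofLp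

/-- The entry `β_τ` of the row vector `zᵀ A⁻¹ Vᵀ`, where `V` has the rows `y_τᵀ`, `τ ∈ Ψ`. -/
noncomputable def beta {d : ℕ} (y : ℕ → EuclideanSpace ℝ (Fin d)) (Ψ : Finset ℕ)
    (z : EuclideanSpace ℝ (Fin d)) (τ : ℕ) : ℝ :=
  z.ofLp ⬝ᵥ ((gram y Ψ)⁻¹ *ᵥ (y τ).ofLp)

/-- The truncation level `h = ‖zᵀ A⁻¹ Vᵀ‖_{1+ε}`. -/
noncomputable def level {d : ℕ} (ε : ℝ) (y : ℕ → EuclideanSpace ℝ (Fin d)) (Ψ : Finset ℕ)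
    (z : EuclideanSpace ℝ (Fin d)) : ℝ :=
  (∑ τ ∈ Ψ, |beta y Ψ z τ| ^ (1 + ε)) ^ (1 / (1 + ε))

open Classical in
/-- The payoff of round `τ`, replaced by `0` if `|β_τ r_τ|` exceeds the truncation level. -/
noncomputable def truncPayoff {d : ℕ} (ε : ℝ) (y : ℕ → EuclideanSpace ℝ (Fin d)) (p : ℕ → ℝ)
    (Ψ : Finset ℕ) (z : EuclideanSpace ℝ (Fin d)) (τ : ℕ) : ℝ :=
  if |beta y Ψ z τ * p τ| ≤ level ε y Ψ z then p τ else 0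

/-- The adaptive estimator `θ̂ = A⁻¹ Vᵀ Ŷ`. -/
noncomputable def thetaHat {d : ℕ} (ε : ℝ) (y : ℕ → EuclideanSpace ℝ (Fin d)) (p : ℕ → ℝ)
    (Ψ : Finset ℕ) (z : EuclideanSpace ℝ (Fin d)) : Fin d → ℝ :=
  (gram y Ψ)⁻¹ *ᵥ ∑ τ ∈ Ψ, truncPayoff ε y p Ψ z τ • (y τ).ofLp

/-- The estimated payoff `r̂ = zᵀ θ̂`. -/
noncomputable def estimate {d : ℕ} (ε : ℝ) (y : ℕ → EuclideanSpace ℝ (Fin d)) (p : ℕ → ℝ)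
    (Ψ : Finset ℕ) (z : EuclideanSpace ℝ (Fin d)) : ℝ :=
  z.ofLp ⬝ᵥ thetaHat ε y p Ψ z

/-- `(2/3) ln (2 T K ln T / δ) + √(2 v ln (2 T K ln T / δ)) + v`. -/
noncomputable def confConst (K T : ℕ) (v δ : ℝ) : ℝ :=
  2 / 3 * Real.log (2 * T * K * Real.log T / δ)
    + √(2 * Real.log (2 * T * K * Real.log T / δ) * v) + v

/-- The parameter `α_t` of BTC in round `t`. -/
noncomputable def alpha (K T : ℕ) (ε v δ : ℝ) (t : ℕ) : ℝ :=
  confConst K T v δ * (t : ℝ) ^ ((1 - ε) / (2 * (1 + ε)))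

/-- The width `(α + 1) √(zᵀ A⁻¹ z)` of the confidence interval. -/
noncomputable def width {d : ℕ} (α : ℝ) (y : ℕ → EuclideanSpace ℝ (Fin d)) (Ψ : Finset ℕ)
    (z : EuclideanSpace ℝ (Fin d)) : ℝ :=
  (α + 1) * √(z.ofLp ⬝ᵥ ((gram y Ψ)⁻¹ *ᵥ z.ofLp))

/-! The master algorithm. Rounds are numbered `1, …, T` and stages are numbered from `1` on. -/

/-- What the learner remembers: the arms played, the payoffs observed for them, and the current
index sets `Ψ^s`. Entries for rounds that are still to come are placeholders. -/
structure History (K : ℕ) where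
  arm : ℕ → Fin K
  payoff : ℕ → ℝ
  idx : ℕ → Finset ℕ

/-- How the choices are resolved that the algorithm leaves open. In round `t` at stage `s`,
`explore t s w C` picks one arm of the set `C` of candidates whose width exceeds `2^{-s}`
(it may look at the widths `w`, e.g. to pick the widest one), and `exploit t s C` picks one arm of
the set `C` of candidates that maximize the upper confidence bound. -/
structure ChoiceRule (K : ℕ) where
  explore : ℕ → ℕ → (Fin K → ℝ) → Finset (Fin K) → Fin K
  exploit : ℕ → ℕ → Finset (Fin K) → Fin K
  explore_mem : ∀ t s w C, C.Nonempty → explore t s w C ∈ C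
  exploit_mem : ∀ t s C, C.Nonempty → exploit t s C ∈ C

/-- Everything the learner is given: horizon `T`, moment order `1 + ε`, moment bound `v`,
confidence `δ`, the contexts `x t a` (those of round `t` are used from round `t` on), and the rule
that resolves open choices. -/
structure Input (K d : ℕ) where
  T : ℕ
  ε : ℝ
  v : ℝ
  δ : ℝ
  x : ℕ → Fin K → EuclideanSpace ℝ (Fin d)
  rule : ChoiceRule K

/-- The context of the arm played in round `τ`. -/
def playedContext {K d : ℕ} (I : Input K d) (H : History K) (τ : ℕ) : EuclideanSpace ℝ (Fin d) :=
  I.x τ (H.arm τ)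

/-- The width `w_{t,a}^s` that BTC returns for the index set `Ψ^s`. -/
noncomputable def stageWidth {K d : ℕ} (I : Input K d) (H : History K) (t s : ℕ) (a : Fin K) : ℝ :=
  width (alpha K I.T I.ε I.v I.δ t) (playedContext I H) (H.idx s) (I.x t a)

/-- The upper confidence bound `r̂_{t,a}^s + w_{t,a}^s` that BTC returns for `Ψ^s`. -/
noncomputable def stageUCB {K d : ℕ} (I : Input K d) (H : History K) (t s : ℕ) (a : Fin K) : ℝ :=
  estimate I.ε (playedContext I H) H.payoff (H.idx s) (I.x t a) + stageWidth I H t s a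

open Classical in
/-- The set `Â_s` of candidates in round `t`: `Â_1` holds all arms, and `Â_{s+1}` holds the arms of
`Â_s` whose upper confidence bound is within `2^{1-s}` of the largest one. (Index `0` is unused.) -/
noncomputable def candidates {K d : ℕ} (I : Input K d) (H : History K) (t : ℕ) :
    ℕ → Finset (Fin K)
  | 0 => Finset.univ
  | 1 => Finset.univ
  | s + 2 => (candidates I H t (s + 1)).filter fun a =>
      ∀ a' ∈ candidates I H t (s + 1),
        stageUCB I H t (s + 1) a' - (2 : ℝ) ^ (1 - ((s + 1 : ℕ) : ℤ)) ≤ stageUCB I H t (s + 1) a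

/-- First case of the loop body: all candidates have width at most `1/√T`. -/
def Accurate {K d : ℕ} (I : Input K d) (H : History K) (t s : ℕ) : Prop :=
  ∀ a ∈ candidates I H t s, stageWidth I H t s a ≤ 1 / √(I.T : ℝ)

open Classical in
/-- The candidates of stage `s` whose width exceeds `2^{-s}`. -/
noncomputable def wide {K d : ℕ} (I : Input K d) (H : History K) (t s : ℕ) : Finset (Fin K) :=
  (candidates I H t s).filter fun a => (2 : ℝ) ^ (-(s : ℤ)) < stageWidth I H t s a

open Classical in
/-- The candidates of stage `s` that maximize the upper confidence bound. -/
noncomputable def best {K d : ℕ} (I : Input K d) (H : History K) (t s : ℕ) : Finset (Fin K) :=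
  (candidates I H t s).filter fun a =>
    ∀ a' ∈ candidates I H t s, stageUCB I H t s a' ≤ stageUCB I H t s a

/-- An arm is found at stage `s`: one of the first two cases of the loop body applies. -/
def Found {K d : ℕ} (I : Input K d) (H : History K) (t s : ℕ) : Prop :=
  Accurate I H t s ∨ (wide I H t s).Nonempty

/-- The loop over the stages terminates. -/
theorem exists_found {K d : ℕ} (I : Input K d) (hT : 0 < I.T) (H : History K) (t : ℕ) :
    ∃ s, 1 ≤ s ∧ Found I H t s := by
  have h : (0 : ℝ) < 1 / √(I.T : ℝ) := by
    have : (0 : ℝ) < I.T := by exact_mod_cast hT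
    positivity
  obtain ⟨n, hn⟩ := exists_pow_lt_of_lt_one h (by norm_num : (1 / 2 : ℝ) < 1)
  refine ⟨n + 1, by omega, ?_⟩
  by_cases hA : Accurate I H t (n + 1)
  · exact Or.inl hA
  · refine Or.inr ?_
    unfold Accurate at hA
    push Not at hA
    obtain ⟨a, ha, hw⟩ := hA
    refine ⟨a, ?_⟩
    unfold wide
    refine Finset.mem_filter.2 ⟨ha, lt_trans ?_ hw⟩
    refine lt_of_le_of_lt ?_ hn
    rw [zpow_neg, zpow_natCast, one_div, inv_pow]
    gcongr
    · norm_num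
    · omega

/-- The stage at which the loop of round `t` stops: the first one at which an arm is found. -/
noncomputable def finalStage {K d : ℕ} (I : Input K d) (H : History K) (t : ℕ) : ℕ :=
  sInf {s | 1 ≤ s ∧ Found I H t s}

open Classical in
/-- The arm `a_t` played in round `t`. -/
noncomputable def chosenArm {K d : ℕ} (I : Input K d) (H : History K) (t : ℕ) : Fin K :=
  let s := finalStage I H t
  if Accurate I H t s then I.rule.exploit t s (best I H t s)
  else I.rule.explore t s (stageWidth I H t s) (wide I H t s)

open Classical in
/-- The index sets after round `t`: if the arm was chosen for exploration at stage `s ≤ S`, where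
`S = ⌊ln T⌋`, then `t` is added to `Ψ^s`; nothing else changes. -/
noncomputable def nextIdx {K d : ℕ} (I : Input K d) (H : History K) (t : ℕ) (s' : ℕ) : Finset ℕ :=
  if ¬ Accurate I H t (finalStage I H t) ∧ s' = finalStage I H t ∧ s' ≤ ⌊Real.log I.T⌋₊
  then insert t (H.idx s') else H.idx s'

/-- The history after `n` rounds if playing arm `a` in round `t` yields the payoff `r t a`.
Only the payoffs of played arms are looked at. -/
noncomputable def run {K d : ℕ} [NeZero K] (I : Input K d) (r : ℕ → Fin K → ℝ) : ℕ → History K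
  | 0 => { arm := fun _ => 0, payoff := fun _ => 0, idx := fun _ => ∅ }
  | n + 1 =>
    let H := run I r n
    let a := chosenArm I H (n + 1)
    { arm := Function.update H.arm (n + 1) a
      payoff := Function.update H.payoff (n + 1) (r (n + 1) a)
      idx := nextIdx I H (n + 1) }

/-- The regret `∑_{t=1}^T (max_a ⟨x_{t,a}, θ⟩ - ⟨x_{t,a_t}, θ⟩)` of SupBTC on the payoffs `r`. -/
noncomputable def regret {K d : ℕ} [NeZero K] (I : Input K d) (θ : EuclideanSpace ℝ (Fin d))
    (r : ℕ → Fin K → ℝ) : ℝ :=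
  ∑ t ∈ Finset.Icc 1 I.T,
    ((⨆ a, inner ℝ (I.x t a) θ) - inner ℝ (I.x t ((run I r I.T).arm t)) θ)

end SupBTC

/-! Confidence. The ridge weights `β` reproduce `zᵀθ` up to a bias of `√(zᵀA⁻¹z)`. Truncating at `h
= ‖β‖_{1+ε}` turns the moment bound `v` into a total second moment of at most `v h²` and a
truncation bias of at most `v h`. For weights fixed in advance, Bernstein's inequality then bounds
the error by `confConst * h` with high probability (`truncated_sum_deviation`), and `h` is at most
`√(zᵀA⁻¹z)` times the power of `t` in `α_t` (`level_le`).

Independence. The weights are random, because the index sets and the arms are. But whether a round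
enters `Ψ^s`, and with which arm, is decided by widths, which ignore payoffs, and by estimates of
stages below `s`. So the payoffs observed in `Ψ^s` influence neither `Ψ^s` nor its arms
(`agree_run`). For every possible design, the event that it occurs depends on rounds outside it, and
the deviation event on rounds inside it; these events are independent. Summing over the countably
many designs transfers the bound to the random one (`measure_deviates_le`). A union bound over `T`
rounds, at most `ln T` stages and `K` arms costs `δ`.

Regret. If all intervals cover, a best arm survives and the candidates of stage `s` are `8 *
2⁻ˢ`-optimal (`Covers.candidates_spec`). A round then costs at most `2/√T` if it exploits, `4 *
2^{-S}` if it explores beyond stage `S`, and eight widths otherwise (`gap_le`). The forms `zᵀA⁻¹z`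
of explored arms are paid for by the growth of `2 ln det A`, so their sum telescopes, and
Cauchy–Schwarz over the rounds finishes the proof. -/

namespace SupBTC

/-! ### Ridge regression and the determinant potential -/

section Ridge

variable {d : ℕ} (y : ℕ → EuclideanSpace ℝ (Fin d)) (Ψ : Finset ℕ)

theorem gram_posDef : (gram y Ψ).PosDef := by
  unfold gram
  refine Matrix.PosDef.one.add_posSemidef (Matrix.posSemidef_sum _ fun τ _ => ?_)
  simpa using Matrix.posSemidef_vecMulVec_self_star (y τ).ofLp

theorem gram_congr {y y' : ℕ → EuclideanSpace ℝ (Fin d)} {Ψ : Finset ℕ}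
    (h : ∀ τ ∈ Ψ, y τ = y' τ) : gram y Ψ = gram y' Ψ := by
  unfold gram
  congr 1
  exact Finset.sum_congr rfl fun τ hτ => by rw [h τ hτ]

theorem dotProduct_self_nonneg (u : Fin d → ℝ) : 0 ≤ u ⬝ᵥ u :=
  Finset.sum_nonneg fun i _ => mul_self_nonneg (u i)

theorem dotProduct_eq_inner (a b : EuclideanSpace ℝ (Fin d)) :
    a.ofLp ⬝ᵥ b.ofLp = inner ℝ a b := by
  rw [EuclideanSpace.inner_eq_star_dotProduct, dotProduct_comm]
  simp

theorem dotProduct_self_eq_norm_sq (a : EuclideanSpace ℝ (Fin d)) :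
    a.ofLp ⬝ᵥ a.ofLp = ‖a‖ ^ 2 := by
  rw [dotProduct_eq_inner, real_inner_self_eq_norm_sq]

theorem abs_dotProduct_le (a b : Fin d → ℝ) : |a ⬝ᵥ b| ≤ √(a ⬝ᵥ a) * √(b ⬝ᵥ b) := by
  have h := abs_real_inner_le_norm (WithLp.toLp 2 a) (WithLp.toLp 2 b)
  rw [← dotProduct_eq_inner] at h
  have e : ∀ c : Fin d → ℝ, √(c ⬝ᵥ c) = ‖(WithLp.toLp 2 c : EuclideanSpace ℝ (Fin d))‖ := by
    intro c
    rw [← Real.sqrt_sq (norm_nonneg _), ← dotProduct_self_eq_norm_sq]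
  rw [e, e]
  exact h

theorem gram_mulVec (u : Fin d → ℝ) :
    gram y Ψ *ᵥ u = u + ∑ τ ∈ Ψ, ((y τ).ofLp ⬝ᵥ u) • (y τ).ofLp := by
  unfold gram
  rw [Matrix.add_mulVec, Matrix.one_mulVec, Matrix.sum_mulVec]
  congr 1
  refine Finset.sum_congr rfl fun τ _ => ?_
  rw [Matrix.vecMulVec_mulVec]
  ext i
  simp [mul_comm]

theorem isUnit_det_gram : IsUnit (gram y Ψ).det :=
  (gram_posDef y Ψ).det_pos.ne'.isUnit

theorem gram_mulVec_inv_mulVec (z : Fin d → ℝ) :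
    gram y Ψ *ᵥ ((gram y Ψ)⁻¹ *ᵥ z) = z := by
  rw [Matrix.mulVec_mulVec, Matrix.mul_nonsing_inv _ (isUnit_det_gram y Ψ), Matrix.one_mulVec]

theorem gram_inv_transpose : ((gram y Ψ)⁻¹)ᵀ = (gram y Ψ)⁻¹ := by
  have h := (gram_posDef y Ψ).isHermitian.inv
  rwa [Matrix.IsHermitian, Matrix.conjTranspose_eq_transpose_of_trivial] at h

theorem dotProduct_gram_inv_mulVec_comm (a b : Fin d → ℝ) :
    a ⬝ᵥ ((gram y Ψ)⁻¹ *ᵥ b) = b ⬝ᵥ ((gram y Ψ)⁻¹ *ᵥ a) := by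
  rw [Matrix.dotProduct_mulVec, ← Matrix.mulVec_transpose, gram_inv_transpose, dotProduct_comm]

/-- The quadratic form `zᵀ A⁻¹ z`. -/
noncomputable def invForm (z : EuclideanSpace ℝ (Fin d)) : ℝ :=
  z.ofLp ⬝ᵥ ((gram y Ψ)⁻¹ *ᵥ z.ofLp)

/-- Expand `z = A (A⁻¹ z)`. The true parameter as `θ` gives the bias of the estimator; `θ = A⁻¹ z`
gives the norm identity `invForm_eq`. -/
theorem dotProduct_decomp (z θ : EuclideanSpace ℝ (Fin d)) :
    z.ofLp ⬝ᵥ θ.ofLp = ((gram y Ψ)⁻¹ *ᵥ z.ofLp) ⬝ᵥ θ.ofLp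
      + ∑ τ ∈ Ψ, beta y Ψ z τ * ((y τ).ofLp ⬝ᵥ θ.ofLp) := by
  conv_lhs => rw [← gram_mulVec_inv_mulVec y Ψ z.ofLp]
  rw [gram_mulVec, add_dotProduct, sum_dotProduct]
  congr 1
  refine Finset.sum_congr rfl fun τ _ => ?_
  rw [smul_dotProduct, smul_eq_mul, beta, dotProduct_gram_inv_mulVec_comm]

theorem invForm_eq (z : EuclideanSpace ℝ (Fin d)) :
    invForm y Ψ z = ((gram y Ψ)⁻¹ *ᵥ z.ofLp) ⬝ᵥ ((gram y Ψ)⁻¹ *ᵥ z.ofLp)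
      + ∑ τ ∈ Ψ, beta y Ψ z τ ^ 2 := by
  have h := dotProduct_decomp y Ψ z (WithLp.toLp 2 ((gram y Ψ)⁻¹ *ᵥ z.ofLp))
  unfold invForm
  simp only at h
  rw [h]
  congr 1
  refine Finset.sum_congr rfl fun τ _ => ?_
  rw [sq]
  congr 1
  rw [beta, dotProduct_gram_inv_mulVec_comm]

theorem invForm_nonneg (z : EuclideanSpace ℝ (Fin d)) : 0 ≤ invForm y Ψ z := by
  rw [invForm_eq]
  exact add_nonneg (dotProduct_self_nonneg _) (Finset.sum_nonneg fun _ _ => sq_nonneg _)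

theorem sum_beta_sq_le (z : EuclideanSpace ℝ (Fin d)) :
    ∑ τ ∈ Ψ, beta y Ψ z τ ^ 2 ≤ invForm y Ψ z := by
  rw [invForm_eq]
  exact le_add_of_nonneg_left (dotProduct_self_nonneg _)

theorem dotProduct_inv_self_le (z : EuclideanSpace ℝ (Fin d)) :
    ((gram y Ψ)⁻¹ *ᵥ z.ofLp) ⬝ᵥ ((gram y Ψ)⁻¹ *ᵥ z.ofLp) ≤ invForm y Ψ z := by
  rw [invForm_eq]
  exact le_add_of_nonneg_right (Finset.sum_nonneg fun _ _ => sq_nonneg _)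

/-- With `u = zᵀA⁻¹z`, Cauchy–Schwarz gives `u ≤ ‖z‖ ‖A⁻¹z‖ ≤ √u`. -/
theorem invForm_le_one {z : EuclideanSpace ℝ (Fin d)} (hz : ‖z‖ ≤ 1) : invForm y Ψ z ≤ 1 := by
  have h1 := abs_dotProduct_le z.ofLp ((gram y Ψ)⁻¹ *ᵥ z.ofLp)
  have h2 : √(z.ofLp ⬝ᵥ z.ofLp) ≤ 1 := by
    rw [dotProduct_self_eq_norm_sq, Real.sqrt_sq (norm_nonneg _)]
    exact hz
  have h3 := Real.sqrt_le_sqrt (dotProduct_inv_self_le y Ψ z)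
  have h0 := invForm_nonneg y Ψ z
  have h4 : invForm y Ψ z ≤ √(invForm y Ψ z) := by
    calc invForm y Ψ z ≤ |invForm y Ψ z| := le_abs_self _
      _ ≤ _ := h1
      _ ≤ 1 * √(invForm y Ψ z) := by gcongr
      _ = _ := one_mul _
  have h5 := Real.sq_sqrt h0
  nlinarith [Real.sqrt_nonneg (invForm y Ψ z)]

/-- The bias of ridge regression. -/
theorem abs_inner_sub_sum_le (z θ : EuclideanSpace ℝ (Fin d)) (hθ : ‖θ‖ ≤ 1) :
    |inner ℝ z θ - ∑ τ ∈ Ψ, beta y Ψ z τ * inner ℝ (y τ) θ| ≤ √(invForm y Ψ z) := by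
  have h := dotProduct_decomp y Ψ z θ
  simp only [dotProduct_eq_inner z θ, fun τ => dotProduct_eq_inner (y τ) θ] at h
  rw [h, add_sub_cancel_right]
  refine (abs_dotProduct_le _ _).trans ?_
  have h2 : √(θ.ofLp ⬝ᵥ θ.ofLp) ≤ 1 := by
    rw [dotProduct_self_eq_norm_sq, Real.sqrt_sq (norm_nonneg _)]
    exact hθ
  calc _ ≤ √(invForm y Ψ z) * 1 := by
        gcongr
        exact dotProduct_inv_self_le y Ψ z
    _ = _ := mul_one _

theorem estimate_eq (ε : ℝ) (p : ℕ → ℝ) (z : EuclideanSpace ℝ (Fin d)) :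
    estimate ε y p Ψ z = ∑ τ ∈ Ψ, beta y Ψ z τ * truncPayoff ε y p Ψ z τ := by
  unfold estimate thetaHat
  rw [dotProduct_gram_inv_mulVec_comm, sum_dotProduct]
  refine Finset.sum_congr rfl fun τ _ => ?_
  rw [smul_dotProduct, smul_eq_mul, mul_comm, beta, dotProduct_gram_inv_mulVec_comm]

theorem level_nonneg (ε : ℝ) (z : EuclideanSpace ℝ (Fin d)) : 0 ≤ level ε y Ψ z := by
  unfold level
  exact Real.rpow_nonneg (Finset.sum_nonneg fun _ _ => Real.rpow_nonneg (abs_nonneg _) _) _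

/-- Power mean inequality between the exponents `1 + ε` and `2`, followed by `∑ β² ≤ zᵀA⁻¹z`. -/
theorem level_le {ε : ℝ} (hε : 0 < ε) (hε1 : ε ≤ 1) (z : EuclideanSpace ℝ (Fin d)) {t : ℝ}
    (ht : (Ψ.card : ℝ) ≤ t) :
    level ε y Ψ z ≤ t ^ ((1 - ε) / (2 * (1 + ε))) * √(invForm y Ψ z) := by
  have hp : 1 ≤ 2 / (1 + ε) := by rw [le_div_iff₀ (by linarith)]; linarith
  have h := Real.rpow_sum_le_const_mul_sum_rpow Ψ (fun τ => |beta y Ψ z τ| ^ (1 + ε)) hp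
  have hS : (0 : ℝ) ≤ ∑ τ ∈ Ψ, |beta y Ψ z τ| ^ (1 + ε) :=
    Finset.sum_nonneg fun _ _ => Real.rpow_nonneg (abs_nonneg _) _
  have e1 : ∀ τ, |(|beta y Ψ z τ| ^ (1 + ε))| = |beta y Ψ z τ| ^ (1 + ε) := fun τ =>
    abs_of_nonneg (Real.rpow_nonneg (abs_nonneg _) _)
  have e2 : ∀ τ, (|beta y Ψ z τ| ^ (1 + ε)) ^ (2 / (1 + ε)) = beta y Ψ z τ ^ 2 := by
    intro τ
    rw [← Real.rpow_mul (abs_nonneg _), mul_div_cancel₀ _ (by linarith : (1 + ε) ≠ 0)]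
    norm_num
  simp only [e1, e2] at h
  have hc : (0 : ℝ) ≤ Ψ.card := Nat.cast_nonneg _
  have h2 : level ε y Ψ z ^ 2 ≤ (t ^ ((1 - ε) / (2 * (1 + ε))) * √(invForm y Ψ z)) ^ 2 := by
    rw [mul_pow, Real.sq_sqrt (invForm_nonneg y Ψ z)]
    unfold level
    rw [← Real.rpow_natCast, ← Real.rpow_mul hS, ← Real.rpow_natCast (t ^ _),
      ← Real.rpow_mul (hc.trans ht)]
    have a1 : 1 / (1 + ε) * ((2 : ℕ) : ℝ) = 2 / (1 + ε) := by push_cast; ring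
    have a2 : (1 - ε) / (2 * (1 + ε)) * ((2 : ℕ) : ℝ) = 2 / (1 + ε) - 1 := by
      have : (1 + ε) ≠ 0 := by linarith
      push_cast; field_simp; ring
    rw [a1, a2]
    refine h.trans ?_
    have := Real.rpow_nonneg (hc.trans ht) (2 / (1 + ε) - 1)
    gcongr
    · exact sum_beta_sq_le y Ψ z
  exact (sq_le_sq₀ (level_nonneg y Ψ ε z)
    (mul_nonneg (Real.rpow_nonneg (hc.trans ht) _) (Real.sqrt_nonneg _))).1 h2

theorem gram_insert {t : ℕ} (ht : t ∉ Ψ) :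
    gram y (insert t Ψ) = gram y Ψ + Matrix.vecMulVec (y t).ofLp (y t).ofLp := by
  unfold gram
  rw [Finset.sum_insert ht]
  abel

theorem det_gram_insert {t : ℕ} (ht : t ∉ Ψ) :
    (gram y (insert t Ψ)).det = (gram y Ψ).det * (1 + invForm y Ψ (y t)) := by
  rw [gram_insert y Ψ ht, Matrix.vecMulVec_eq Unit,
    Matrix.det_add_replicateCol_mul_replicateRow (isUnit_det_gram y Ψ)]
  congr 1
  rw [Matrix.det_unique]
  simp only [Matrix.add_apply, Matrix.one_apply_eq]
  congr 1
  rw [invForm, Matrix.dotProduct_mulVec]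
  rfl

/-- By the matrix determinant lemma `ln det` grows by `ln (1 + u)`, and `u ≤ 2 ln (1 + u)` for `0 ≤
u ≤ 1`. -/
theorem invForm_le_log_det {t : ℕ} (ht : t ∉ Ψ) (hy : ‖y t‖ ≤ 1) :
    invForm y Ψ (y t)
      ≤ 2 * Real.log (gram y (insert t Ψ)).det - 2 * Real.log (gram y Ψ).det := by
  have h0 := invForm_nonneg y Ψ (y t)
  have h1 := invForm_le_one y Ψ hy
  rw [det_gram_insert y Ψ ht, Real.log_mul (gram_posDef y Ψ).det_pos.ne' (by linarith)]
  have h2 := Real.one_sub_inv_le_log_of_pos (show 0 < 1 + invForm y Ψ (y t) by linarith)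
  have h3 : invForm y Ψ (y t) / 2 ≤ 1 - (1 + invForm y Ψ (y t))⁻¹ := by
    have : 1 - (1 + invForm y Ψ (y t))⁻¹ = invForm y Ψ (y t) / (1 + invForm y Ψ (y t)) := by
      field_simp; ring
    rw [this]
    gcongr
    linarith
  linarith

theorem trace_gram : (gram y Ψ).trace = d + ∑ τ ∈ Ψ, ‖y τ‖ ^ 2 := by
  unfold gram
  rw [Matrix.trace_add, Matrix.trace_sum]
  simp [Matrix.trace_vecMulVec, dotProduct_self_eq_norm_sq]

/-- Every eigenvalue is at most the trace. This is cruder than AM–GM, but the loss is only inside a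
logarithm. -/
theorem log_det_gram_le (hy : ∀ τ, ‖y τ‖ ≤ 1) :
    Real.log (gram y Ψ).det ≤ d * Real.log (d + Ψ.card) := by
  have hH := gram_posDef y Ψ
  have htr : (gram y Ψ).trace ≤ d + Ψ.card := by
    rw [trace_gram]
    gcongr
    refine (Finset.sum_le_card_nsmul _ _ 1 fun τ _ => ?_).trans (by simp)
    exact pow_le_one₀ (norm_nonneg _) (hy τ)
  have hle : ∀ i, hH.1.eigenvalues i ≤ d + Ψ.card := fun i => by
    refine le_trans ?_ htr
    rw [hH.1.trace_eq_sum_eigenvalues]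
    exact Finset.single_le_sum (f := fun i => hH.1.eigenvalues i)
      (fun i _ => (hH.eigenvalues_pos i).le) (Finset.mem_univ i)
  rw [← Real.log_pow]
  refine Real.log_le_log hH.det_pos ?_
  rw [hH.1.det_eq_prod_eigenvalues]
  calc _ ≤ ∏ i : Fin d, ((d : ℝ) + Ψ.card) :=
        Finset.prod_le_prod (fun i _ => (hH.eigenvalues_pos i).le) fun i _ => hle i
    _ = _ := by simp

end Ridge

/-! ### Bernstein's inequality and truncation -/

section Bernstein

/-- From the quadratic term on, the exponential series is dominated by a geometric one, since `(n +
2)! ≥ 2 * 3 ^ n`. -/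
theorem exp_le_of_abs_le {u c : ℝ} (hu : |u| ≤ c) (hc : c < 3) :
    Real.exp u ≤ 1 + u + u ^ 2 / 2 * (1 - c / 3)⁻¹ := by
  have hc0 : 0 ≤ c := (abs_nonneg u).trans hu
  have h1 : HasSum (fun n : ℕ => u ^ n / n.factorial) (Real.exp u) := by
    rw [Real.exp_eq_exp_ℝ]
    exact NormedSpace.expSeries_div_hasSum_exp u
  have h2 := (hasSum_nat_add_iff' 2).2 h1
  have h3 : HasSum (fun n : ℕ => u ^ 2 / 2 * (c / 3) ^ n) (u ^ 2 / 2 * (1 - c / 3)⁻¹) :=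
    (hasSum_geometric_of_lt_one (by positivity) (by linarith)).mul_left _
  have h4 := hasSum_le (fun n => ?_) h2 h3
  · simp [Finset.sum_range_succ] at h4
    linarith
  · have hf : (2 * 3 ^ n : ℝ) ≤ ((n + 2).factorial : ℝ) := by
      have := Nat.factorial_mul_pow_le_factorial (m := 2) (n := n)
      rw [add_comm 2 n] at this
      exact_mod_cast this
    calc u ^ (n + 2) / ((n + 2).factorial : ℝ) ≤ u ^ 2 * c ^ n / ((n + 2).factorial : ℝ) := by
          gcongr
          rw [pow_add, mul_comm]
          refine mul_le_mul_of_nonneg_left ?_ (sq_nonneg u)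
          exact (le_abs_self _).trans ((abs_pow u n).trans_le (by gcongr))
      _ ≤ u ^ 2 * c ^ n / (2 * 3 ^ n) := by gcongr
      _ = _ := by rw [div_pow]; field_simp

variable {Ω : Type*} [MeasurableSpace Ω] {μ : Measure Ω} [IsProbabilityMeasure μ]

theorem integrable_of_abs_le {X : Ω → ℝ} (hm : Measurable X) {h : ℝ} (hb : ∀ ω, |X ω| ≤ h) :
    Integrable X μ :=
  Integrable.of_bound hm.aestronglyMeasurable h (.of_forall hb)

theorem mgf_le_of_abs_le {X : Ω → ℝ} (hm : Measurable X) {h c : ℝ} (hh : 0 < h)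
    (hb : ∀ ω, |X ω| ≤ h) (hc0 : 0 ≤ c) (hc : c < 3) :
    mgf X μ (c / h) ≤ Real.exp (c / h * ∫ ω, X ω ∂μ
      + (c / h) ^ 2 / 2 * (1 - c / 3)⁻¹ * ∫ ω, X ω ^ 2 ∂μ) := by
  have hi := integrable_of_abs_le (μ := μ) hm hb
  have hi2 : Integrable (fun ω => X ω ^ 2) μ :=
    integrable_of_abs_le (hm.pow_const 2) (h := h ^ 2) fun ω => by
      rw [abs_pow]; gcongr; exact hb ω
  have hu : ∀ ω, |c / h * X ω| ≤ c := fun ω => by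
    rw [abs_mul, abs_of_nonneg (by positivity)]
    calc c / h * |X ω| ≤ c / h * h := by gcongr; exact hb ω
      _ = c := by field_simp
  have key : mgf X μ (c / h) ≤ ∫ ω, (1 + c / h * X ω
      + (c / h) ^ 2 / 2 * (1 - c / 3)⁻¹ * X ω ^ 2) ∂μ := by
    refine integral_mono (integrable_of_abs_le (h := Real.exp c) (by fun_prop) fun ω => ?_)
      (by fun_prop) fun ω => ?_
    · rw [Real.abs_exp]
      exact Real.exp_le_exp.2 (le_of_abs_le (hu ω))
    · refine (exp_le_of_abs_le (hu ω) hc).trans_eq ?_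
      ring
  refine key.trans ?_
  rw [integral_add (by fun_prop) (by fun_prop), integral_add (by fun_prop) (by fun_prop),
    integral_const_mul, integral_const_mul]
  simp only [integral_const, probReal_univ, smul_eq_mul, mul_one]
  rw [add_assoc, add_comm]
  exact Real.add_one_le_exp _

/-- Bernstein's inequality for independent bounded variables, in terms of second moments. -/
theorem bernstein {ι : Type*} (s : Finset ι) {X : ι → Ω → ℝ} (hind : iIndepFun X μ)
    (hm : ∀ i, Measurable (X i)) {h V L : ℝ} (hh : 0 < h) (hV : 0 < V) (hL : 0 < L)
    (hb : ∀ i ω, |X i ω| ≤ h) (hvar : ∑ i ∈ s, ∫ ω, X i ω ^ 2 ∂μ ≤ h ^ 2 * V) :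
    μ.real {ω | ∑ i ∈ s, ∫ ω', X i ω' ∂μ + h * (√(2 * L * V) + L / 3) ≤ ∑ i ∈ s, X i ω}
      ≤ Real.exp (-L) := by
  set q : ℝ := √(2 * L / V) with hq
  have hq0 : 0 < q := Real.sqrt_pos.2 (by positivity)
  have hq2 : q ^ 2 * V = 2 * L := by rw [hq, Real.sq_sqrt (by positivity)]; field_simp
  have hqs : √(2 * L * V) = q * V := by
    rw [← hq2, show q ^ 2 * V * V = (q * V) ^ 2 by ring, Real.sqrt_sq (by positivity)]
  -- The Chernoff parameter is `c / h`; this `c` makes the final exponent exactly `-L`.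
  set c : ℝ := q / (1 + q / 3) with hc
  have hc0 : 0 < c := by positivity
  have hc3 : c < 3 := by rw [hc, div_lt_iff₀ (by positivity)]; linarith
  have hinv : (1 - c / 3)⁻¹ = 1 + q / 3 := by
    rw [inv_eq_iff_eq_inv, hc]; field_simp; ring
  have hexp : Integrable (fun ω => Real.exp (c / h * (∑ i ∈ s, X i) ω)) μ := by
    refine integrable_of_abs_le (h := Real.exp (c / h * ∑ i ∈ s, h)) ?_ fun ω => ?_
    · simp only [Finset.sum_apply]
      fun_prop
    · rw [Real.abs_exp, Real.exp_le_exp, Finset.sum_apply]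
      gcongr with i _
      exact le_of_abs_le (hb i ω)
  have h1 := measure_ge_le_exp_mul_mgf (μ := μ) (X := ∑ i ∈ s, X i)
    (∑ i ∈ s, ∫ ω', X i ω' ∂μ + h * (√(2 * L * V) + L / 3)) (by positivity : 0 ≤ c / h) hexp
  simp only [Finset.sum_apply] at h1
  refine h1.trans ?_
  rw [hind.mgf_sum hm]
  calc _ ≤ Real.exp (-(c / h) * (∑ i ∈ s, ∫ ω', X i ω' ∂μ + h * (√(2 * L * V) + L / 3)))
        * ∏ i ∈ s, Real.exp (c / h * ∫ ω, X i ω ∂μ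
            + (c / h) ^ 2 / 2 * (1 - c / 3)⁻¹ * ∫ ω, X i ω ^ 2 ∂μ) := by
        gcongr with i _
        · exact fun i _ => mgf_nonneg
        · exact mgf_le_of_abs_le (hm i) hh (hb i) hc0.le hc3
    _ = Real.exp (-c * (√(2 * L * V) + L / 3)
        + (c / h) ^ 2 / 2 * (1 - c / 3)⁻¹ * ∑ i ∈ s, ∫ ω, X i ω ^ 2 ∂μ) := by
        rw [← Real.exp_sum, ← Real.exp_add, Finset.sum_add_distrib, ← Finset.mul_sum,
          ← Finset.mul_sum]
        congr 1
        field_simp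
        ring
    _ ≤ Real.exp (-c * (√(2 * L * V) + L / 3)
        + (c / h) ^ 2 / 2 * (1 - c / 3)⁻¹ * (h ^ 2 * V)) := by
        rw [hinv]
        gcongr
    _ = Real.exp (-L) := by
        congr 1
        rw [hinv, hqs]
        have e1 : c * (1 + q / 3) = q := by rw [hc]; field_simp
        have e2 : (c / h) ^ 2 / 2 * (1 + q / 3) * (h ^ 2 * V) = c * (c * (1 + q / 3)) * V / 2 := by
          field_simp
        rw [e2, e1]
        have e3 : L = q * (q * V) / 2 := by linarith
        have e4 : L * (c * (1 + q / 3)) = L * q := by rw [e1]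
        have e5 : q * (c * (q * V / 2 + L / 3)) = q * L := by
          have : q * (q * V / 2) = L := by linarith
          calc q * (c * (q * V / 2 + L / 3)) = c * (q * (q * V / 2) + q * L / 3) := by ring
            _ = c * (L + q * L / 3) := by rw [this]
            _ = L * (c * (1 + q / 3)) := by ring
            _ = q * L := by rw [e4]; ring
        have e6 := mul_left_cancel₀ hq0.ne' e5
        linarith

variable {ε v L : ℝ}

open Classical in
/-- The value `b * p` if it is at most `h` in absolute value, and `0` otherwise. -/
noncomputable def truncMul (h b p : ℝ) : ℝ := b * if |b * p| ≤ h then p else 0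

theorem measurable_truncMul (h b : ℝ) : Measurable (truncMul h b) := by
  unfold truncMul
  refine Measurable.const_mul (Measurable.ite ?_ measurable_id measurable_const) _
  exact measurableSet_le (by fun_prop) measurable_const

theorem truncMul_eq (h b p : ℝ) [Decidable (|b * p| ≤ h)] :
    truncMul h b p = if |b * p| ≤ h then b * p else 0 := by
  unfold truncMul
  split_ifs <;> simp

theorem abs_truncMul_le {h : ℝ} (hh : 0 ≤ h) (b p : ℝ) : |truncMul h b p| ≤ h := by
  classical
  rw [truncMul_eq]
  split_ifs with hp
  · exact hp
  · simpa using hh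

/-- Of the two factors `|b p|`, the power `1 - ε` is bounded by the truncation level. -/
theorem truncMul_sq_le (hε : 0 < ε) (hε1 : ε ≤ 1) {h : ℝ} (hh : 0 < h) (b p : ℝ) :
    truncMul h b p ^ 2 ≤ h ^ (1 - ε) * |b| ^ (1 + ε) * |p| ^ (1 + ε) := by
  classical
  rw [truncMul_eq, mul_assoc, ← Real.mul_rpow (abs_nonneg _) (abs_nonneg _), ← abs_mul]
  split_ifs with hp
  · calc (b * p) ^ 2 = |b * p| ^ (1 - ε) * |b * p| ^ (1 + ε) := by
          rw [← Real.rpow_add_of_nonneg (abs_nonneg _) (by linarith) (by linarith), ← sq_abs]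
          norm_num
      _ ≤ _ := by
          gcongr
  · rw [zero_pow two_ne_zero]
    positivity

/-- The difference is nonzero only where `|b p| > h`, and there `h ^ ε ≤ |b p| ^ ε`. -/
theorem abs_mul_sub_truncMul_le (hε : 0 < ε) {h : ℝ} (hh : 0 < h) (b p : ℝ) :
    |truncMul h b p - b * p| ≤ h ^ (-ε) * |b| ^ (1 + ε) * |p| ^ (1 + ε) := by
  classical
  rw [truncMul_eq, mul_assoc, ← Real.mul_rpow (abs_nonneg _) (abs_nonneg _), ← abs_mul]
  split_ifs with hp
  · rw [sub_self, abs_zero]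
    positivity
  · push Not at hp
    have h0 : 0 < |b * p| := hh.trans hp
    rw [zero_sub, abs_neg, Real.rpow_neg hh.le, Real.rpow_add h0, Real.rpow_one,
      inv_mul_eq_div, le_div_iff₀ (by positivity)]
    gcongr

/-- The choice of `h` means `∑ |β| ^ (1 + ε) = h ^ (1 + ε)`, so the two truncation bounds sum to `h
^ 2 * v` and `v * h`, and everything scales with `h`. -/
theorem truncated_sum_deviation (hε : 0 < ε) (hε1 : ε ≤ 1) (hv : 0 < v) (hL : 0 < L)
    (Ψ : Finset ℕ) (β m : ℕ → ℝ) {p : ℕ → Ω → ℝ} (hind : iIndepFun p μ)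
    (hm : ∀ τ, Measurable (p τ)) (hint : ∀ τ, Integrable (fun ω => |p τ ω| ^ (1 + ε)) μ)
    (hmom : ∀ τ, ∫ ω, |p τ ω| ^ (1 + ε) ∂μ ≤ v) (hmean : ∀ τ, ∫ ω, p τ ω ∂μ = m τ)
    {h : ℝ} (hh : h = (∑ τ ∈ Ψ, |β τ| ^ (1 + ε)) ^ (1 / (1 + ε))) :
    μ.real {ω | (2 / 3 * L + √(2 * L * v) + v) * h
      < |∑ τ ∈ Ψ, truncMul h (β τ) (p τ ω) - ∑ τ ∈ Ψ, β τ * m τ|} ≤ 2 * Real.exp (-L) := by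
  set B : ℝ := ∑ τ ∈ Ψ, |β τ| ^ (1 + ε) with hB
  have hB0 : 0 ≤ B := Finset.sum_nonneg fun _ _ => by positivity
  have hh0 : 0 ≤ h := hh ▸ Real.rpow_nonneg hB0 _
  -- If `h = 0`, all weights vanish and the strict inequality cannot hold.
  rcases hB0.eq_or_lt with hBz | hBpos
  · have hβ : ∀ τ ∈ Ψ, β τ = 0 := fun τ hτ => by
      have := (Finset.sum_eq_zero_iff_of_nonneg fun _ _ => by positivity).1 hBz.symm τ hτ
      rw [Real.rpow_eq_zero_iff_of_nonneg (abs_nonneg _)] at this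
      simpa using this.1
    have e : {ω | (2 / 3 * L + √(2 * L * v) + v) * h
        < |∑ τ ∈ Ψ, truncMul h (β τ) (p τ ω) - ∑ τ ∈ Ψ, β τ * m τ|} = ∅ := by
      ext ω
      simp only [Set.mem_ofPred_eq, Set.mem_empty_iff_false, iff_false, not_lt]
      rw [Finset.sum_eq_zero fun τ hτ => by rw [truncMul, hβ τ hτ, zero_mul],
        Finset.sum_eq_zero fun τ hτ => by rw [hβ τ hτ, zero_mul]]
      simp only [sub_self, abs_zero]
      positivity
    rw [e, measureReal_empty]
    positivity
  have hpos : 0 < h := hh ▸ Real.rpow_pos_of_pos hBpos _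
  have hBh : B = h ^ (1 + ε) := by
    rw [hh, ← Real.rpow_mul hB0, one_div, inv_mul_cancel₀ (by linarith), Real.rpow_one]
  have hpint : ∀ τ, Integrable (p τ) μ := fun τ => by
    refine ((integrable_const (1 : ℝ)).add (hint τ)).mono' (hm τ).aestronglyMeasurable
      (.of_forall fun ω => ?_)
    rw [Real.norm_eq_abs, Pi.add_apply]
    rcases le_total |p τ ω| 1 with h1 | h1
    · have : 0 ≤ |p τ ω| ^ (1 + ε) := by positivity
      linarith
    · have := Real.rpow_le_rpow_of_exponent_le h1 (by linarith : 1 ≤ 1 + ε)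
      rw [Real.rpow_one] at this
      linarith
  set X : ℕ → Ω → ℝ := fun τ ω => truncMul h (β τ) (p τ ω) with hX
  have hXm : ∀ τ, Measurable (X τ) := fun τ => (measurable_truncMul h (β τ)).comp (hm τ)
  have hXb : ∀ τ ω, |X τ ω| ≤ h := fun τ ω => abs_truncMul_le hh0 _ _
  have hXi : ∀ τ, Integrable (X τ) μ := fun τ => integrable_of_abs_le (hXm τ) (hXb τ)
  have hXind : iIndepFun X μ := hind.comp _ fun τ => measurable_truncMul h (β τ)
  have hvar : ∑ τ ∈ Ψ, ∫ ω, X τ ω ^ 2 ∂μ ≤ h ^ 2 * v := by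
    calc _ ≤ ∑ τ ∈ Ψ, h ^ (1 - ε) * |β τ| ^ (1 + ε) * v := by
          gcongr with τ _
          calc _ ≤ ∫ ω, h ^ (1 - ε) * |β τ| ^ (1 + ε) * |p τ ω| ^ (1 + ε) ∂μ :=
                integral_mono (integrable_of_abs_le ((hXm τ).pow_const 2) (h := h ^ 2) fun ω => by
                  rw [abs_pow]; gcongr; exact hXb τ ω) ((hint τ).const_mul _)
                  fun ω => truncMul_sq_le hε hε1 hpos _ _
            _ ≤ _ := by rw [integral_const_mul]; gcongr; exact hmom τ
      _ = h ^ 2 * v := by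
          rw [← Finset.sum_mul, ← Finset.mul_sum, ← hB, hBh, ← Real.rpow_add hpos]
          norm_num
  have hbias : |∑ τ ∈ Ψ, ∫ ω, X τ ω ∂μ - ∑ τ ∈ Ψ, β τ * m τ| ≤ v * h := by
    rw [← Finset.sum_sub_distrib]
    refine (Finset.abs_sum_le_sum_abs _ _).trans ?_
    calc _ ≤ ∑ τ ∈ Ψ, h ^ (-ε) * |β τ| ^ (1 + ε) * v := by
          gcongr with τ _
          rw [← hmean, ← integral_const_mul, ← integral_sub (hXi τ) ((hpint τ).const_mul _)]
          calc _ ≤ ∫ ω, |X τ ω - β τ * p τ ω| ∂μ := abs_integral_le_integral_abs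
            _ ≤ ∫ ω, h ^ (-ε) * |β τ| ^ (1 + ε) * |p τ ω| ^ (1 + ε) ∂μ :=
                integral_mono ((hXi τ).sub ((hpint τ).const_mul _)).abs ((hint τ).const_mul _)
                  fun ω => abs_mul_sub_truncMul_le hε hpos _ _
            _ ≤ _ := by rw [integral_const_mul]; gcongr; exact hmom τ
      _ = v * h := by
          rw [← Finset.sum_mul, ← Finset.mul_sum, ← hB, hBh, ← Real.rpow_add hpos, mul_comm]
          norm_num
  have hup := bernstein Ψ hXind hXm hpos hv hL hXb hvar
  have hneg : iIndepFun (fun τ ω => -X τ ω) μ :=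
    hXind.comp (fun _ => Neg.neg) fun _ => measurable_neg
  have hlow := bernstein Ψ hneg (fun τ => (hXm τ).neg) hpos hv hL
    (fun τ ω => by rw [abs_neg]; exact hXb τ ω) (by simpa using hvar)
  refine (measureReal_mono (fun ω hω => ?_) (measure_ne_top _ _)).trans
    ((measureReal_union_le _ _).trans ((add_le_add hup hlow).trans_eq (two_mul _).symm))
  simp only [Set.mem_ofPred_eq, Set.mem_union, integral_neg, Finset.sum_neg_distrib] at hω ⊢
  obtain ⟨hb1, hb2⟩ := abs_le.1 hbias
  -- Bernstein needs only `L / 3`; the remaining `L / 3` of the constant is slack.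
  have hLh : 0 ≤ L * h := by positivity
  rcases lt_abs.1 hω with h1 | h1
  · left; nlinarith
  · right; nlinarith

end Bernstein

/-! ### Maps with countable range and measurable fibres -/

section Discrete

variable {α β γ : Type*} [MeasurableSpace α]

/-- A map with countably many values, all of whose fibres are measurable. -/
def IsDiscrete (f : α → β) : Prop :=
  (Set.range f).Countable ∧ ∀ b, MeasurableSet (f ⁻¹' {b})

theorem IsDiscrete.of_countable [Countable β] {f : α → β}
    (h : ∀ b, MeasurableSet (f ⁻¹' {b})) : IsDiscrete f :=
  ⟨Set.to_countable _, h⟩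

theorem IsDiscrete.const (b : β) : IsDiscrete fun _ : α => b :=
  ⟨(Set.countable_singleton b).mono (by rintro _ ⟨_, rfl⟩; rfl), fun c =>
    MeasurableSet.const (b = c)⟩

/-- This handles a step that depends on earlier discrete data: fix the data, check the step, and
take a countable union over the fibres. It needs no σ-algebra on the space of histories. -/
theorem IsDiscrete.bind {f : α → β} (hf : IsDiscrete f) {g : β → α → γ}
    (hg : ∀ b, IsDiscrete (g b)) : IsDiscrete fun ω => g (f ω) ω := by
  constructor
  · refine (hf.1.biUnion fun b _ => (hg b).1).mono ?_
    rintro _ ⟨ω, rfl⟩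
    exact Set.mem_biUnion (Set.mem_range_self ω) (Set.mem_range_self ω)
  · intro c
    have : (fun ω => g (f ω) ω) ⁻¹' {c} = ⋃ b ∈ Set.range f, f ⁻¹' {b} ∩ g b ⁻¹' {c} := by
      ext ω
      simp only [Set.mem_preimage, Set.mem_singleton_iff, Set.mem_iUnion, Set.mem_inter_iff,
        Set.mem_range, exists_prop]
      constructor
      · exact fun h => ⟨f ω, ⟨ω, rfl⟩, rfl, h⟩
      · rintro ⟨b, -, rfl, h⟩
        exact h
    rw [this]
    exact MeasurableSet.biUnion hf.1 fun b _ => (hf.2 b).inter ((hg b).2 c)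

theorem IsDiscrete.comp {f : α → β} (hf : IsDiscrete f) (g : β → γ) :
    IsDiscrete fun ω => g (f ω) :=
  hf.bind (g := fun b _ => g b) fun b => .const (g b)

theorem IsDiscrete.comp₂ {δ : Type*} {f : α → β} {f' : α → γ} (hf : IsDiscrete f)
    (hf' : IsDiscrete f') (g : β → γ → δ) : IsDiscrete fun ω => g (f ω) (f' ω) :=
  hf.bind (g := fun b ω => g b (f' ω)) fun b => hf'.comp (g b)

theorem IsDiscrete.measurableSet {p : α → Prop} (hp : IsDiscrete p) : MeasurableSet {ω | p ω} := by
  convert hp.2 True using 1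
  ext ω
  simp

theorem isDiscrete_filter {ι : Type*} [Finite ι] (C : Finset ι) {p : α → ι → Prop}
    [∀ ω, DecidablePred (p ω)]
    (hp : ∀ a, MeasurableSet {ω | p ω a}) : IsDiscrete fun ω => C.filter (p ω) := by
  have := Fintype.ofFinite ι
  refine .of_countable fun D => ?_
  have : (fun ω => C.filter (p ω)) ⁻¹' {D} = ⋂ a, {ω | (a ∈ C ∧ p ω a) ↔ a ∈ D} := by
    ext ω
    simp [Finset.ext_iff]
  rw [this]
  refine MeasurableSet.iInter fun a => ?_
  have h1 := (MeasurableSet.const (a ∈ C)).inter (hp a)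
  by_cases ha : a ∈ D
  · simpa [ha, Set.inter_def] using h1
  · convert h1.compl using 1
    ext ω
    simp [ha]

end Discrete

/-! ### One round as a function of the payoffs, for fixed past arms and index sets -/

section FixedDesign

variable {α : Type*} [MeasurableSpace α] {K d : ℕ} (I : Input K d) (arm : ℕ → Fin K)
  (Φ : ℕ → Finset ℕ) {p : α → ℕ → ℝ} (hp : ∀ τ, Measurable fun ω => p ω τ)

include hp

theorem measurable_stageUCB (t s : ℕ) (a : Fin K) :
    Measurable fun ω => stageUCB I ⟨arm, p ω, Φ⟩ t s a := by
  -- The width ignores payoffs, so it is a constant, written with payoff `0`.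
  change Measurable fun ω => estimate I.ε (fun τ => I.x τ (arm τ)) (p ω) (Φ s) (I.x t a)
    + stageWidth I ⟨arm, 0, Φ⟩ t s a
  refine Measurable.add_const ?_ _
  simp only [estimate_eq]
  refine Finset.measurable_sum _ fun τ _ => Measurable.const_mul ?_ _
  refine Measurable.ite (measurableSet_le ?_ measurable_const) (hp τ) measurable_const
  exact ((hp τ).const_mul _).abs

theorem isDiscrete_candidates (t s : ℕ) :
    IsDiscrete fun ω => candidates I ⟨arm, p ω, Φ⟩ t s := by
  classical
  induction s with
  | zero => exact .const _
  | succ s ih =>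
    cases s with
    | zero => exact .const _
    | succ s =>
      refine ih.bind (g := fun C ω => C.filter fun a => ∀ a' ∈ C,
        stageUCB I ⟨arm, p ω, Φ⟩ t (s + 1) a' - (2 : ℝ) ^ (1 - ((s + 1 : ℕ) : ℤ))
          ≤ stageUCB I ⟨arm, p ω, Φ⟩ t (s + 1) a) fun C => isDiscrete_filter C fun a => ?_
      simp only [Set.ofPred_forall]
      refine MeasurableSet.biInter C.countable_toSet fun a' _ => ?_
      exact measurableSet_le ((measurable_stageUCB I arm Φ hp t _ a').sub_const _)
        (measurable_stageUCB I arm Φ hp t _ a)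

theorem isDiscrete_best (t s : ℕ) : IsDiscrete fun ω => best I ⟨arm, p ω, Φ⟩ t s := by
  classical
  refine (isDiscrete_candidates I arm Φ hp t s).bind (g := fun C ω => C.filter fun a => ∀ a' ∈ C,
      stageUCB I ⟨arm, p ω, Φ⟩ t s a' ≤ stageUCB I ⟨arm, p ω, Φ⟩ t s a)
    fun C => isDiscrete_filter C fun a => ?_
  simp only [Set.ofPred_forall]
  refine MeasurableSet.biInter C.countable_toSet fun a' _ => ?_
  exact measurableSet_le (measurable_stageUCB I arm Φ hp t _ a')
    (measurable_stageUCB I arm Φ hp t _ a)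

theorem isDiscrete_accurate (t s : ℕ) : IsDiscrete fun ω => Accurate I ⟨arm, p ω, Φ⟩ t s :=
  (isDiscrete_candidates I arm Φ hp t s).comp fun C =>
    ∀ a ∈ C, stageWidth I ⟨arm, 0, Φ⟩ t s a ≤ 1 / √(I.T : ℝ)

open Classical in
theorem isDiscrete_wide (t s : ℕ) : IsDiscrete fun ω => wide I ⟨arm, p ω, Φ⟩ t s :=
  (isDiscrete_candidates I arm Φ hp t s).comp fun C =>
    C.filter fun a => (2 : ℝ) ^ (-(s : ℤ)) < stageWidth I ⟨arm, 0, Φ⟩ t s a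

theorem isDiscrete_found (t s : ℕ) : IsDiscrete fun ω => Found I ⟨arm, p ω, Φ⟩ t s :=
  (isDiscrete_accurate I arm Φ hp t s).comp₂ (isDiscrete_wide I arm Φ hp t s)
    fun A W => A ∨ W.Nonempty

theorem isDiscrete_finalStage (hT : 0 < I.T) (t : ℕ) :
    IsDiscrete fun ω => finalStage I ⟨arm, p ω, Φ⟩ t := by
  classical
  refine .of_countable fun n => ?_
  have hne := fun ω => exists_found I hT ⟨arm, p ω, Φ⟩ t
  have hms : ∀ s, MeasurableSet {ω | 1 ≤ s ∧ Found I ⟨arm, p ω, Φ⟩ t s} := fun s =>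
    (MeasurableSet.const _).inter (isDiscrete_found I arm Φ hp t s).measurableSet
  have h := measurable_find hne hms (measurableSet_singleton n)
  have he : (fun ω => finalStage I ⟨arm, p ω, Φ⟩ t) = fun ω => Nat.find (hne ω) := by
    funext ω
    refine (Nat.sInf_def (hne ω)).trans ?_
    congr
  rw [he]
  exact h

theorem isDiscrete_chosenArm (hT : 0 < I.T) (t : ℕ) :
    IsDiscrete fun ω => chosenArm I ⟨arm, p ω, Φ⟩ t := by
  classical
  refine (isDiscrete_finalStage I arm Φ hp hT t).bind
    (g := fun s ω => if Accurate I ⟨arm, p ω, Φ⟩ t s then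
        I.rule.exploit t s (best I ⟨arm, p ω, Φ⟩ t s)
      else I.rule.explore t s (stageWidth I ⟨arm, p ω, Φ⟩ t s) (wide I ⟨arm, p ω, Φ⟩ t s))
    fun s => ?_
  refine (isDiscrete_accurate I arm Φ hp t s).bind
    (g := fun A ω => if A then
        I.rule.exploit t s (best I ⟨arm, p ω, Φ⟩ t s)
      else I.rule.explore t s (stageWidth I ⟨arm, p ω, Φ⟩ t s) (wide I ⟨arm, p ω, Φ⟩ t s))
    fun A => ?_
  by_cases hA : A
  · simp only [hA, if_true]
    exact (isDiscrete_best I arm Φ hp t s).comp _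
  · simp only [hA, if_false]
    exact (isDiscrete_wide I arm Φ hp t s).comp
      (I.rule.explore t s (stageWidth I ⟨arm, 0, Φ⟩ t s))

theorem isDiscrete_nextIdx (hT : 0 < I.T) (t : ℕ) :
    IsDiscrete fun ω => nextIdx I ⟨arm, p ω, Φ⟩ t := by
  classical
  refine (isDiscrete_finalStage I arm Φ hp hT t).bind
    (g := fun s ω s' => if ¬ Accurate I ⟨arm, p ω, Φ⟩ t s ∧ s' = s ∧ s' ≤ ⌊Real.log I.T⌋₊
      then insert t (Φ s') else Φ s') fun s => ?_
  exact (isDiscrete_accurate I arm Φ hp t s).comp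
    fun A s' => if ¬ A ∧ s' = s ∧ s' ≤ ⌊Real.log I.T⌋₊ then insert t (Φ s') else Φ s'

end FixedDesign

/-! ### Bookkeeping along a run -/

section Run

variable {K d : ℕ} [NeZero K] (I : Input K d)

theorem run_arm_eq (r : ℕ → Fin K → ℝ) {n m τ : ℕ} (hτ : τ ≤ n) (h : n ≤ m) :
    (run I r m).arm τ = (run I r n).arm τ := by
  induction m, h using Nat.le_induction with
  | base => rfl
  | succ m h ih =>
    rw [← ih]
    exact Function.update_of_ne (by omega) _ _

theorem run_arm_succ (r : ℕ → Fin K → ℝ) (n : ℕ) :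
    (run I r (n + 1)).arm (n + 1) = chosenArm I (run I r n) (n + 1) :=
  Function.update_self _ _ _

/-- The remembered payoffs are a function of `r` and the arms, so arms and index sets are the only
discrete data to track. -/
theorem run_payoff (r : ℕ → Fin K → ℝ) (n : ℕ) :
    (run I r n).payoff = fun τ => if τ ∈ Finset.Icc 1 n then r τ ((run I r n).arm τ) else 0 := by
  induction n with
  | zero => ext τ; simp [run]
  | succ n ih =>
    ext τ
    change Function.update (run I r n).payoff (n + 1) _ τ = _
    by_cases h : τ = n + 1
    · subst h
      rw [Function.update_self, if_pos (by simp), run_arm_succ]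
    · rw [Function.update_of_ne h, ih]
      have h1 : (run I r (n + 1)).arm τ = (run I r n).arm τ := Function.update_of_ne h _ _
      have h2 : τ ∈ Finset.Icc 1 (n + 1) ↔ τ ∈ Finset.Icc 1 n := by
        simp only [Finset.mem_Icc]; omega
      simp only [h1, h2]

theorem mem_run_idx_succ (r : ℕ → Fin K → ℝ) (n s τ : ℕ) :
    τ ∈ (run I r (n + 1)).idx s ↔ τ ∈ (run I r n).idx s ∨
      (τ = n + 1 ∧ ¬ Accurate I (run I r n) (n + 1) (finalStage I (run I r n) (n + 1))
        ∧ s = finalStage I (run I r n) (n + 1) ∧ s ≤ ⌊Real.log I.T⌋₊) := by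
  change τ ∈ nextIdx I (run I r n) (n + 1) s ↔ _
  unfold nextIdx
  split_ifs with h
  · rw [Finset.mem_insert]
    tauto
  · tauto

theorem run_idx_mono (r : ℕ → Fin K → ℝ) {n m : ℕ} (h : n ≤ m) (s : ℕ) :
    (run I r n).idx s ⊆ (run I r m).idx s := by
  induction m, h using Nat.le_induction with
  | base => exact subset_rfl
  | succ m h ih => exact fun τ hτ => (mem_run_idx_succ I r m s τ).2 (.inl (ih hτ))

theorem run_idx_subset (r : ℕ → Fin K → ℝ) (n s : ℕ) :
    (run I r n).idx s ⊆ Finset.Icc 1 n := by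
  induction n with
  | zero => simp [run]
  | succ n ih =>
    intro τ hτ
    rw [mem_run_idx_succ] at hτ
    rw [Finset.mem_Icc]
    rcases hτ with hτ | hτ
    · have := Finset.mem_Icc.1 (ih hτ)
      omega
    · omega

theorem run_idx_eq_empty (r : ℕ → Fin K → ℝ) (n : ℕ) {s : ℕ} (hs : ⌊Real.log I.T⌋₊ < s) :
    (run I r n).idx s = ∅ := by
  induction n with
  | zero => rfl
  | succ n ih =>
    ext τ
    rw [mem_run_idx_succ, ih]
    simp only [Finset.notMem_empty, false_or, iff_false]
    omega

theorem run_idx_disjoint (r : ℕ → Fin K → ℝ) (n : ℕ) {s s' τ : ℕ}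
    (h : τ ∈ (run I r n).idx s) (h' : τ ∈ (run I r n).idx s') : s = s' := by
  induction n with
  | zero => simp [run] at h
  | succ n ih =>
    rw [mem_run_idx_succ] at h h'
    have hn : ∀ σ, n + 1 ∉ (run I r n).idx σ := fun σ hσ => by
      have := Finset.mem_Icc.1 (run_idx_subset I r n σ hσ)
      omega
    rcases h with h | h <;> rcases h' with h' | h'
    · exact ih h h'
    · exact absurd (h'.1 ▸ h) (hn s)
    · exact absurd (h.1 ▸ h') (hn s')
    · rw [h.2.2.1, h'.2.2.1]

/-- Up to round `n`, the played arms and the index sets take countably many values. -/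
theorem isDiscrete_run (hT : 0 < I.T) (n : ℕ) :
    IsDiscrete fun r : ℕ → Fin K → ℝ => ((run I r n).arm, (run I r n).idx) := by
  induction n with
  | zero =>
    exact .const ((fun _ => 0 : ℕ → Fin K), (fun _ => ∅ : ℕ → Finset ℕ))
  | succ n ih =>
    -- For fixed past arms and index sets `b`, the remembered payoffs are measurable in `r`, so the
    -- next step is discrete.
    have hstep : ∀ b : (ℕ → Fin K) × (ℕ → Finset ℕ), IsDiscrete fun r : ℕ → Fin K → ℝ =>
        (Function.update b.1 (n + 1) (chosenArm I ⟨b.1,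
          fun τ => if τ ∈ Finset.Icc 1 n then r τ (b.1 τ) else 0, b.2⟩ (n + 1)),
        nextIdx I ⟨b.1, fun τ => if τ ∈ Finset.Icc 1 n then r τ (b.1 τ) else 0, b.2⟩
          (n + 1)) := fun b => by
      have hp : ∀ τ, Measurable fun r : ℕ → Fin K → ℝ =>
          if τ ∈ Finset.Icc 1 n then r τ (b.1 τ) else 0 := fun τ => by
        split_ifs <;> fun_prop
      exact (isDiscrete_chosenArm I b.1 b.2 hp hT (n + 1)).comp₂
        (isDiscrete_nextIdx I b.1 b.2 hp hT (n + 1)) fun a Φ => (Function.update b.1 (n + 1) a, Φ)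
    have h := ih.bind hstep
    simp only [← run_payoff] at h
    exact h

end Run

/-! ### BTC depends only on the rounds of its index set -/

section Congr

variable {d : ℕ} {y y' : ℕ → EuclideanSpace ℝ (Fin d)} {Ψ : Finset ℕ}

theorem beta_congr (h : ∀ τ ∈ Ψ, y τ = y' τ) (z : EuclideanSpace ℝ (Fin d)) {τ : ℕ} (hτ : τ ∈ Ψ) :
    beta y Ψ z τ = beta y' Ψ z τ := by
  unfold beta
  rw [gram_congr h, h τ hτ]

theorem level_congr (ε : ℝ) (h : ∀ τ ∈ Ψ, y τ = y' τ) (z : EuclideanSpace ℝ (Fin d)) :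
    level ε y Ψ z = level ε y' Ψ z := by
  unfold level
  rw [Finset.sum_congr rfl fun τ hτ => by rw [beta_congr h z hτ]]

theorem width_congr (α : ℝ) (h : ∀ τ ∈ Ψ, y τ = y' τ) (z : EuclideanSpace ℝ (Fin d)) :
    width α y Ψ z = width α y' Ψ z := by
  unfold width
  rw [gram_congr h]

theorem estimate_eq_sum_truncMul (ε : ℝ) (y : ℕ → EuclideanSpace ℝ (Fin d)) (Ψ : Finset ℕ)
    (p : ℕ → ℝ) (z : EuclideanSpace ℝ (Fin d)) :
    estimate ε y p Ψ z = ∑ τ ∈ Ψ, truncMul (level ε y Ψ z) (beta y Ψ z τ) (p τ) :=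
  estimate_eq y Ψ ε p z

theorem estimate_congr (ε : ℝ) {p p' : ℕ → ℝ} (h : ∀ τ ∈ Ψ, y τ = y' τ)
    (hp : ∀ τ ∈ Ψ, p τ = p' τ) (z : EuclideanSpace ℝ (Fin d)) :
    estimate ε y p Ψ z = estimate ε y' p' Ψ z := by
  rw [estimate_eq_sum_truncMul, estimate_eq_sum_truncMul]
  refine Finset.sum_congr rfl fun τ hτ => ?_
  rw [level_congr ε h, beta_congr h z hτ, hp τ hτ]

end Congr

/-! ### Payoffs of `Ψ^s` do not influence `Ψ^s` -/

section Agree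

variable {K d : ℕ} (I : Input K d)

/-- Two histories contain the same information for all decisions about the index sets
`Ψ^1, …, Ψ^s`: the payoffs observed in the rounds of `Ψ^s` itself do not matter. -/
structure Agree (s : ℕ) (H H' : History K) : Prop where
  idx : ∀ σ ≤ s, H.idx σ = H'.idx σ
  arm : ∀ σ ≤ s, ∀ τ ∈ H.idx σ, H.arm τ = H'.arm τ
  payoff : ∀ σ < s, ∀ τ ∈ H.idx σ, H.payoff τ = H'.payoff τ

variable {s : ℕ} {H H' : History K}

theorem Agree.symm (h : Agree s H H') : Agree s H' H where
  idx σ hσ := (h.idx σ hσ).symm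
  arm σ hσ τ hτ := (h.arm σ hσ τ (by rwa [h.idx σ hσ])).symm
  payoff σ hσ τ hτ := (h.payoff σ hσ τ (by rwa [h.idx σ hσ.le])).symm

theorem Agree.playedContext_eq (h : Agree s H H') {σ τ : ℕ} (hσ : σ ≤ s) (hτ : τ ∈ H.idx σ) :
    playedContext I H τ = playedContext I H' τ := by
  unfold playedContext
  rw [h.arm σ hσ τ hτ]

theorem Agree.stageWidth_eq (h : Agree s H H') {σ : ℕ} (hσ : σ ≤ s) (t : ℕ) (a : Fin K) :
    stageWidth I H t σ a = stageWidth I H' t σ a := by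
  unfold stageWidth
  rw [← h.idx σ hσ]
  exact width_congr _ (fun τ hτ => h.playedContext_eq I hσ hτ) _

theorem Agree.stageUCB_eq (h : Agree s H H') {σ : ℕ} (hσ : σ < s) (t : ℕ) (a : Fin K) :
    stageUCB I H t σ a = stageUCB I H' t σ a := by
  unfold stageUCB
  rw [h.stageWidth_eq I hσ.le, ← h.idx σ hσ.le,
    estimate_congr I.ε (fun τ hτ => h.playedContext_eq I hσ.le hτ) (h.payoff σ hσ)]

/-- `Â_σ` is cut out by upper confidence bounds of stages strictly below `σ`, so `σ = s` is allowed
here, unlike in `Agree.stageUCB_eq`. -/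
theorem Agree.candidates_eq (h : Agree s H H') {σ : ℕ} (hσ : σ ≤ s) (t : ℕ) :
    candidates I H t σ = candidates I H' t σ := by
  induction σ with
  | zero => rfl
  | succ σ ih =>
    cases σ with
    | zero => rfl
    | succ σ =>
      simp only [candidates]
      rw [ih (by omega)]
      simp only [h.stageUCB_eq I (show σ + 1 < s by omega)]

theorem Agree.accurate_iff (h : Agree s H H') {σ : ℕ} (hσ : σ ≤ s) (t : ℕ) :
    Accurate I H t σ ↔ Accurate I H' t σ := by
  unfold Accurate
  simp only [h.candidates_eq I hσ, h.stageWidth_eq I hσ]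

theorem Agree.wide_eq (h : Agree s H H') {σ : ℕ} (hσ : σ ≤ s) (t : ℕ) :
    wide I H t σ = wide I H' t σ := by
  unfold wide
  simp only [h.candidates_eq I hσ, h.stageWidth_eq I hσ]

theorem Agree.found_iff (h : Agree s H H') {σ : ℕ} (hσ : σ ≤ s) (t : ℕ) :
    Found I H t σ ↔ Found I H' t σ := by
  unfold Found
  rw [h.accurate_iff I hσ, h.wide_eq I hσ]

theorem finalStage_mem (hT : 0 < I.T) (H : History K) (t : ℕ) :
    1 ≤ finalStage I H t ∧ Found I H t (finalStage I H t) :=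
  Nat.sInf_mem (exists_found I hT H t)

theorem Agree.finalStage_le (hT : 0 < I.T) (h : Agree s H H') {t : ℕ}
    (hs : finalStage I H t ≤ s) : finalStage I H' t ≤ finalStage I H t :=
  Nat.sInf_le ⟨(finalStage_mem I hT H t).1, (h.found_iff I hs t).1 (finalStage_mem I hT H t).2⟩

theorem Agree.finalStage_eq (hT : 0 < I.T) (h : Agree s H H') {t : ℕ}
    (hs : finalStage I H t ≤ s) : finalStage I H' t = finalStage I H t :=
  le_antisymm (h.finalStage_le I hT hs)
    (h.symm.finalStage_le I hT ((h.finalStage_le I hT hs).trans hs))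

/-- Exploration looks only at widths and the set of wide arms. Exploitation must be excluded: at
stage `s` it would use the estimates of stage `s`. -/
theorem Agree.chosenArm_eq (hT : 0 < I.T) (h : Agree s H H') {t : ℕ}
    (hs : finalStage I H t ≤ s) (hacc : ¬ Accurate I H t (finalStage I H t)) :
    chosenArm I H t = chosenArm I H' t := by
  have hacc' : ¬ Accurate I H' t (finalStage I H' t) := by
    rwa [h.finalStage_eq I hT hs, ← h.accurate_iff I hs]
  unfold chosenArm
  simp only [if_neg hacc, if_neg hacc', h.finalStage_eq I hT hs, h.wide_eq I hs,
    funext fun a => h.stageWidth_eq I hs t a]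

theorem Agree.explored_iff (hT : 0 < I.T) (h : Agree s H H') {t σ : ℕ} (hσ : σ ≤ s) :
    (¬ Accurate I H t (finalStage I H t) ∧ σ = finalStage I H t ∧ σ ≤ ⌊Real.log I.T⌋₊) →
      (¬ Accurate I H' t (finalStage I H' t) ∧ σ = finalStage I H' t ∧ σ ≤ ⌊Real.log I.T⌋₊) := by
  rintro ⟨h1, rfl, h3⟩
  rw [h.finalStage_eq I hT hσ, ← h.accurate_iff I hσ]
  exact ⟨h1, rfl, h3⟩

/-- Changing the payoffs of the rounds in `Ψ^s` does not influence `Ψ^1, …, Ψ^s`. -/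
theorem agree_run [NeZero K] (hT : 0 < I.T) {r r' : ℕ → Fin K → ℝ} (n s : ℕ)
    (h : ∀ τ ∈ Finset.Icc 1 n, τ ∉ (run I r n).idx s → r τ = r' τ) {m : ℕ} (hm : m ≤ n) :
    Agree s (run I r m) (run I r' m) := by
  induction m with
  | zero => exact ⟨fun _ _ => rfl, fun _ _ _ _ => rfl, fun _ _ _ _ => rfl⟩
  | succ m ih =>
    have A := ih (by omega)
    have hidx : ∀ σ ≤ s, (run I r (m + 1)).idx σ = (run I r' (m + 1)).idx σ := fun σ hσ => by
      ext τ
      rw [mem_run_idx_succ, mem_run_idx_succ, A.idx σ hσ]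
      have h1 := A.explored_iff I hT hσ (t := m + 1)
      have h2 := A.symm.explored_iff I hT hσ (t := m + 1)
      tauto
    have harm : ∀ σ ≤ s, ∀ τ ∈ (run I r (m + 1)).idx σ,
        (run I r (m + 1)).arm τ = (run I r' (m + 1)).arm τ := fun σ hσ τ hτ => by
      rw [mem_run_idx_succ] at hτ
      rcases hτ with hτ | ⟨rfl, h1, rfl, -⟩
      · have hτm := (Finset.mem_Icc.1 (run_idx_subset I r m σ hτ)).2
        rw [run_arm_eq I r hτm (Nat.le_succ m), run_arm_eq I r' hτm (Nat.le_succ m)]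
        exact A.arm σ hσ τ hτ
      · rw [run_arm_succ, run_arm_succ]
        exact A.chosenArm_eq I hT hσ h1
    refine ⟨hidx, harm, fun σ hσ τ hτ => ?_⟩
    have hτm := run_idx_subset I r (m + 1) σ hτ
    simp only [run_payoff, if_pos hτm]
    rw [← harm σ hσ.le τ hτ, h τ (Finset.Icc_subset_Icc_right hm hτm)]
    -- The index sets are disjoint, so a round of `Ψ^σ` with `σ < s` lies outside `Ψ^s`, where `r`
    -- and `r'` coincide.
    exact fun hs => hσ.ne (run_idx_disjoint I r n (run_idx_mono I r hm σ hτ) hs)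

/-- The index set `Ψ^s` after round `n` together with the arms played in the rounds of `Ψ^s`. -/
noncomputable def design [NeZero K] (n s : ℕ) (r : ℕ → Fin K → ℝ) : Finset ℕ × (ℕ → Fin K) :=
  ((run I r n).idx s, fun τ => if τ ∈ (run I r n).idx s then (run I r n).arm τ else 0)

theorem isDiscrete_design [NeZero K] (hT : 0 < I.T) (n s : ℕ) : IsDiscrete (design I n s) :=
  (isDiscrete_run I hT n).comp fun b => (b.2 s, fun τ => if τ ∈ b.2 s then b.1 τ else 0)

theorem design_eq_of_eqOn [NeZero K] (hT : 0 < I.T) {n s : ℕ} {r r' : ℕ → Fin K → ℝ}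
    (h : ∀ τ ∈ Finset.Icc 1 n \ (run I r n).idx s, r τ = r' τ) :
    design I n s r' = design I n s r := by
  have A := agree_run I hT n s (fun τ h1 h2 => h τ (Finset.mem_sdiff.2 ⟨h1, h2⟩)) le_rfl
  unfold design
  rw [← A.idx s le_rfl]
  congr 1
  funext τ
  split_ifs with hτ
  · exact (A.arm s le_rfl τ hτ).symm
  · rfl

end Agree

/-! ### Deviation bound for the random design -/

section Independence

variable {Ω : Type*} [MeasurableSpace Ω] {μ : Measure Ω}

/-- Each event is a preimage under the finitely many coordinates it depends on, the other
coordinates being filled with `0`. -/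
theorem measure_inter_of_dependsOn {E : Type*} [MeasurableSpace E] [Zero E] {Y : ℕ → Ω → E}
    (hm : ∀ t, Measurable (Y t)) (hind : iIndepFun Y μ) {S T : Finset ℕ} (hST : Disjoint S T)
    {A B : Set (ℕ → E)} (hA : MeasurableSet A) (hB : MeasurableSet B)
    (hAS : ∀ r r' : ℕ → E, (∀ τ ∈ S, r τ = r' τ) → (r ∈ A ↔ r' ∈ A))
    (hBT : ∀ r r' : ℕ → E, (∀ τ ∈ T, r τ = r' τ) → (r ∈ B ↔ r' ∈ B)) :
    μ {ω | (fun t => Y t ω) ∈ A ∧ (fun t => Y t ω) ∈ B}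
      = μ {ω | (fun t => Y t ω) ∈ A} * μ {ω | (fun t => Y t ω) ∈ B} := by
  classical
  have key := hind.indepFun_finset S T hST hm
  let e : (U : Finset ℕ) → (U → E) → ℕ → E := fun U g τ => if h : τ ∈ U then g ⟨τ, h⟩ else 0
  have he : ∀ U, Measurable (e U) := fun U => by
    refine measurable_pi_lambda _ fun τ => ?_
    by_cases h : τ ∈ U
    · simpa [e, h] using measurable_pi_apply _
    · simp [e, h]
  have heq : ∀ (U : Finset ℕ) (C : Set (ℕ → E)),
      (∀ r r' : ℕ → E, (∀ τ ∈ U, r τ = r' τ) → (r ∈ C ↔ r' ∈ C)) →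
      {ω | (fun t => Y t ω) ∈ C} = (fun ω (i : U) => Y i ω) ⁻¹' (e U ⁻¹' C) := fun U C hC => by
    ext ω
    exact hC _ _ fun τ hτ => by simp [e, hτ]
  have h := key.measure_inter_preimage_eq_mul _ _ (he S hA) (he T hB)
  rw [← heq S A hAS, ← heq T B hBT] at h
  exact h

/-- Law of total probability over the fibres of `f`; it replaces conditioning. -/
theorem measure_le_of_discrete [IsProbabilityMeasure μ] {β : Type*} {f : Ω → β}
    (hf : IsDiscrete f) {D : β → Set Ω} {p : ENNReal}
    (h : ∀ b, μ (f ⁻¹' {b} ∩ D b) ≤ p * μ (f ⁻¹' {b})) :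
    μ {ω | ω ∈ D (f ω)} ≤ p := by
  have hsub : {ω | ω ∈ D (f ω)} ⊆ ⋃ b ∈ Set.range f, f ⁻¹' {b} ∩ D b := fun ω hω =>
    Set.mem_biUnion (Set.mem_range_self ω) ⟨rfl, hω⟩
  calc μ {ω | ω ∈ D (f ω)} ≤ ∑' b : Set.range f, μ (f ⁻¹' {(b : β)} ∩ D b) :=
        (measure_mono hsub).trans (measure_biUnion_le μ hf.1 _)
    _ ≤ ∑' b : Set.range f, p * μ (f ⁻¹' {(b : β)}) := ENNReal.tsum_le_tsum fun b => h b
    _ = p := by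
        rw [ENNReal.tsum_mul_left, tsum_measure_preimage_singleton hf.1 fun b _ => hf.2 b]
        simp

theorem IsDiscrete.comp_measurable {α β : Type*} [MeasurableSpace α] {f : α → β}
    (hf : IsDiscrete f) {g : Ω → α} (hg : Measurable g) : IsDiscrete fun ω => f (g ω) :=
  ⟨hf.1.mono (Set.range_comp_subset_range g f), fun b => hg (hf.2 b)⟩

variable {K d : ℕ} [NeZero K] (I : Input K d)

/-- The deviation bound for the estimate of a fixed arm in round `n + 1` at stage `s` fails. -/
def Deviates (θ : EuclideanSpace ℝ (Fin d)) (c : ℝ) (n s : ℕ) (z : EuclideanSpace ℝ (Fin d))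
    (r : ℕ → Fin K → ℝ) : Prop :=
  let H := run I r n
  c * level I.ε (playedContext I H) (H.idx s) z
    < |estimate I.ε (playedContext I H) H.payoff (H.idx s) z
      - ∑ τ ∈ H.idx s, beta (playedContext I H) (H.idx s) z τ * inner ℝ (playedContext I H τ) θ|

theorem measure_deviates_le [IsProbabilityMeasure μ] (hT : 0 < I.T) (hε : 0 < I.ε) (hε1 : I.ε ≤ 1)
    {v L : ℝ} (hv : 0 < v) (hL : 0 < L) (θ : EuclideanSpace ℝ (Fin d)) {r : ℕ → Fin K → Ω → ℝ}
    (hmeas : ∀ t a, Measurable (r t a))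
    (hindep : iIndepFun (fun (t : ℕ) (ω : Ω) (a : Fin K) => r t a ω) μ)
    (hint : ∀ t a, Integrable (fun ω => |r t a ω| ^ (1 + I.ε)) μ)
    (hmom : ∀ t a, ∫ ω, |r t a ω| ^ (1 + I.ε) ∂μ ≤ v)
    (hmean : ∀ t a, ∫ ω, r t a ω ∂μ = inner ℝ (I.x t a) θ)
    (n s : ℕ) (z : EuclideanSpace ℝ (Fin d)) :
    μ {ω | Deviates I θ (2 / 3 * L + √(2 * L * v) + v) n s z fun t a => r t a ω}
      ≤ ENNReal.ofReal (2 * Real.exp (-L)) := by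
  set c := 2 / 3 * L + √(2 * L * v) + v with hc
  set Y : ℕ → Ω → Fin K → ℝ := fun t ω a => r t a ω with hY
  have hYm : ∀ t, Measurable (Y t) := fun t => measurable_pi_lambda _ (hmeas t)
  have hRm : Measurable fun ω t => Y t ω := measurable_pi_lambda _ hYm
  -- The deviation event for a deterministic design `b`, as a set of payoff tables.
  let D : Finset ℕ × (ℕ → Fin K) → Set (ℕ → Fin K → ℝ) := fun b =>
    {ρ | c * level I.ε (fun τ => I.x τ (b.2 τ)) b.1 z
      < |∑ τ ∈ b.1, truncMul (level I.ε (fun τ => I.x τ (b.2 τ)) b.1 z)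
            (beta (fun τ => I.x τ (b.2 τ)) b.1 z τ) (ρ τ (b.2 τ))
        - ∑ τ ∈ b.1, beta (fun τ => I.x τ (b.2 τ)) b.1 z τ * inner ℝ (I.x τ (b.2 τ)) θ|}
  have hDm : ∀ b, MeasurableSet (D b) := fun b => by
    refine measurableSet_lt measurable_const ?_
    refine Measurable.abs (Measurable.sub_const ?_ _)
    exact Finset.measurable_sum _ fun τ _ => (measurable_truncMul _ _).comp (by fun_prop)
  have hDev : ∀ ρ, Deviates I θ c n s z ρ ↔ ρ ∈ D (design I n s ρ) := fun ρ => by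
    have hy : ∀ τ ∈ (run I ρ n).idx s, playedContext I (run I ρ n) τ
        = I.x τ ((design I n s ρ).2 τ) := fun τ hτ => by
      simp only [design, if_pos hτ]
      rfl
    have hp : ∀ τ ∈ (run I ρ n).idx s, (run I ρ n).payoff τ
        = ρ τ ((design I n s ρ).2 τ) := fun τ hτ => by
      simp only [design, if_pos hτ, run_payoff, if_pos (run_idx_subset I ρ n s hτ)]
    have hsum : ∑ τ ∈ (run I ρ n).idx s, beta (playedContext I (run I ρ n))
          ((run I ρ n).idx s) z τ * inner ℝ (playedContext I (run I ρ n) τ) θ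
        = ∑ τ ∈ (run I ρ n).idx s, beta (fun τ => I.x τ ((design I n s ρ).2 τ))
          ((run I ρ n).idx s) z τ * inner ℝ (I.x τ ((design I n s ρ).2 τ)) θ :=
      Finset.sum_congr rfl fun τ hτ => by rw [beta_congr hy z hτ, hy τ hτ]
    unfold Deviates
    simp only
    rw [hsum, level_congr I.ε hy, estimate_congr I.ε hy hp, estimate_eq_sum_truncMul]
    rfl
  simp only [hDev]
  refine measure_le_of_discrete (D := fun b => {ω | (fun t => Y t ω) ∈ D b})
    ((isDiscrete_design I hT n s).comp_measurable hRm) fun b => ?_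
  have hprob : μ {ω | (fun t => Y t ω) ∈ D b} ≤ ENNReal.ofReal (2 * Real.exp (-L)) := by
    rw [← ofReal_measureReal]
    refine ENNReal.ofReal_le_ofReal ?_
    exact truncated_sum_deviation hε hε1 hv hL b.1 _ _
      (hindep.comp (fun τ f => f (b.2 τ)) fun τ => measurable_pi_apply _)
      (fun τ => hmeas τ _) (fun τ => hint τ _) (fun τ => hmom τ _) (fun τ => hmean τ _) rfl
  have hinv : ∀ ρ ρ' : ℕ → Fin K → ℝ, (∀ τ ∈ Finset.Icc 1 n \ b.1, ρ τ = ρ' τ) →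
      design I n s ρ = b → design I n s ρ' = b := fun ρ ρ' h hρ => by
    rw [← hρ]
    refine design_eq_of_eqOn I hT fun τ hτ => h τ ?_
    rw [← hρ]
    exact hτ
  -- The design equals `b` because of rounds outside `b.1`; `D b` reads only rounds in `b.1`.
  have hmul := measure_inter_of_dependsOn hYm hindep (S := Finset.Icc 1 n \ b.1) (T := b.1)
    Finset.sdiff_disjoint ((isDiscrete_design I hT n s).2 b) (hDm b)
    (fun ρ ρ' h => ⟨hinv ρ ρ' h, hinv ρ' ρ fun τ hτ => (h τ hτ).symm⟩)
    (fun ρ ρ' h => by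
      simp only [D, Set.mem_ofPred_eq]
      rw [Finset.sum_congr rfl fun τ hτ => by rw [h τ hτ]])
  calc _ = μ {ω | (fun t => Y t ω) ∈ design I n s ⁻¹' {b}} * μ {ω | (fun t => Y t ω) ∈ D b} := hmul
    _ ≤ μ {ω | (fun t => Y t ω) ∈ design I n s ⁻¹' {b}} * _ := by gcongr
    _ = _ := mul_comm _ _

end Independence

/-! ### Elimination in a single round -/

section Round

variable {K d : ℕ} (I : Input K d) (θ : EuclideanSpace ℝ (Fin d)) (H : History K) (t : ℕ)

/-- All confidence intervals of round `t` contain the expected payoffs. -/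
def Covers : Prop :=
  ∀ s, 1 ≤ s → ∀ a, |estimate I.ε (playedContext I H) H.payoff (H.idx s) (I.x t a)
    - inner ℝ (I.x t a) θ| ≤ stageWidth I H t s a

variable {I θ H t}

theorem Covers.le_ucb (h : Covers I θ H t) {s : ℕ} (hs : 1 ≤ s) (a : Fin K) :
    inner ℝ (I.x t a) θ ≤ stageUCB I H t s a := by
  have := (abs_le.1 (h s hs a)).1
  unfold stageUCB
  linarith

theorem Covers.ucb_le (h : Covers I θ H t) {s : ℕ} (hs : 1 ≤ s) (a : Fin K) :
    stageUCB I H t s a ≤ inner ℝ (I.x t a) θ + 2 * stageWidth I H t s a := by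
  have := (abs_le.1 (h s hs a)).2
  unfold stageUCB
  linarith

theorem stageWidth_le_of_lt_finalStage {s : ℕ} (hs1 : 1 ≤ s) (hs : s < finalStage I H t)
    {a : Fin K} (ha : a ∈ candidates I H t s) : stageWidth I H t s a ≤ (2 : ℝ) ^ (-(s : ℤ)) := by
  have h : ¬ (1 ≤ s ∧ Found I H t s) := Nat.notMem_of_lt_sInf hs
  by_contra hw
  exact h ⟨hs1, .inr ⟨a, Finset.mem_filter.2 ⟨ha, not_le.1 hw⟩⟩⟩

theorem gap_le_two (hθ : ‖θ‖ ≤ 1) (hx : ∀ t a, ‖I.x t a‖ ≤ 1) (a b : Fin K) :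
    inner ℝ (I.x t a) θ - inner ℝ (I.x t b) θ ≤ 2 := by
  have h : ∀ a, |inner ℝ (I.x t a) θ| ≤ 1 := fun a =>
    (abs_real_inner_le_norm _ _).trans (mul_le_one₀ (hx t a) (norm_nonneg _) hθ)
  have h1 := (abs_le.1 (h a)).2
  have h2 := (abs_le.1 (h b)).1
  linarith

/-- An optimal arm is never eliminated, and the arms that survive up to stage `s` are
`8 * 2⁻ˢ`-optimal. -/
theorem Covers.candidates_spec (h : Covers I θ H t) (hθ : ‖θ‖ ≤ 1) (hx : ∀ t a, ‖I.x t a‖ ≤ 1)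
    {b : Fin K} (hb : ∀ a, inner ℝ (I.x t a) θ ≤ inner ℝ (I.x t b) θ) {s : ℕ} (hs1 : 1 ≤ s)
    (hs : s ≤ finalStage I H t) :
    b ∈ candidates I H t s ∧ ∀ a ∈ candidates I H t s,
      inner ℝ (I.x t b) θ - inner ℝ (I.x t a) θ ≤ 8 * (2 : ℝ) ^ (-(s : ℤ)) := by
  induction s, hs1 using Nat.le_induction with
  | base =>
    -- At stage `1` the bound is `8 / 2 = 4`, above the trivial gap `2`.
    refine ⟨Finset.mem_univ _, fun a _ => (gap_le_two hθ hx b a).trans ?_⟩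
    norm_num
  | succ s hs1 ih =>
    obtain ⟨hbs, -⟩ := ih (by omega)
    obtain ⟨s, rfl⟩ : ∃ k, s = k + 1 := ⟨s - 1, by omega⟩
    have hw := fun a (ha : a ∈ candidates I H t (s + 1)) =>
      stageWidth_le_of_lt_finalStage hs1 (by omega) ha
    have e1 : (2 : ℝ) ^ (1 - ((s + 1 : ℕ) : ℤ)) = 2 * (2 : ℝ) ^ (-((s + 1 : ℕ) : ℤ)) := by
      rw [sub_eq_add_neg, zpow_add₀ two_ne_zero, zpow_one]
    have e2 : (2 : ℝ) ^ (-((s + 1 : ℕ) : ℤ)) = 2 * (2 : ℝ) ^ (-((s + 1 + 1 : ℕ) : ℤ)) := by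
      rw [← zpow_one_add₀ two_ne_zero, Nat.cast_succ (s + 1), neg_add, add_comm 1,
        neg_add_cancel_right]
    -- Stage `s` was passed, so its widths are at most `2⁻ˢ`. The tolerance `2^{1-s}` is twice that,
    -- so `b` is kept; a kept arm loses at most `2 * 2⁻ˢ + 2^{1-s} = 8 * 2^{-(s+1)}`.
    refine ⟨Finset.mem_filter.2 ⟨hbs, fun a ha => ?_⟩, fun a ha => ?_⟩
    · have h1 := h.ucb_le hs1 a
      have h2 := h.le_ucb hs1 b
      have h3 := hb a
      have h4 := hw a ha
      rw [e1]
      linarith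
    · obtain ⟨ha1, ha2⟩ := Finset.mem_filter.1 ha
      have h1 := h.ucb_le hs1 a
      have h2 := h.le_ucb hs1 b
      have h3 := ha2 b hbs
      have h4 := hw a ha1
      rw [e1] at h3
      rw [e2] at h3 h4
      linarith

theorem Covers.gap_le_of_accurate (hT : 0 < I.T) (h : Covers I θ H t) (hθ : ‖θ‖ ≤ 1)
    (hx : ∀ t a, ‖I.x t a‖ ≤ 1)
    {b : Fin K} (hb : ∀ a, inner ℝ (I.x t a) θ ≤ inner ℝ (I.x t b) θ)
    (hacc : Accurate I H t (finalStage I H t)) :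
    inner ℝ (I.x t b) θ - inner ℝ (I.x t (chosenArm I H t)) θ ≤ 2 / √(I.T : ℝ) := by
  have hs1 := (finalStage_mem I hT H t).1
  set s := finalStage I H t with hs
  obtain ⟨hbs, -⟩ := h.candidates_spec hθ hx hb hs1 le_rfl
  have hne : (best I H t s).Nonempty := by
    obtain ⟨a, ha, hmax⟩ := Finset.exists_max_image (candidates I H t s)
      (fun a => stageUCB I H t s a) ⟨b, hbs⟩
    exact ⟨a, Finset.mem_filter.2 ⟨ha, hmax⟩⟩
  have hmem := I.rule.exploit_mem t s _ hne
  have hch : chosenArm I H t = I.rule.exploit t s (best I H t s) := by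
    unfold chosenArm
    simp only [← hs, if_pos hacc]
  rw [← hch] at hmem
  obtain ⟨h1, h2⟩ := Finset.mem_filter.1 hmem
  have h3 := h2 b hbs
  have h4 := h.ucb_le hs1 (chosenArm I H t)
  have h5 := h.le_ucb hs1 b
  have h6 := hacc _ h1
  rw [show 2 / √(I.T : ℝ) = 2 * (1 / √(I.T : ℝ)) by ring]
  linarith

theorem chosenArm_mem_wide (hT : 0 < I.T) (hacc : ¬ Accurate I H t (finalStage I H t)) :
    chosenArm I H t ∈ wide I H t (finalStage I H t) := by
  have hne := ((finalStage_mem I hT H t).2).resolve_left hacc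
  have hch : chosenArm I H t = I.rule.explore t (finalStage I H t)
      (stageWidth I H t (finalStage I H t)) (wide I H t (finalStage I H t)) := by
    unfold chosenArm
    simp only [if_neg hacc]
  rw [hch]
  exact I.rule.explore_mem _ _ _ _ hne

end Round

/-! ### Telescoping potential over all stages -/

section Potential

variable {K d : ℕ} [NeZero K] (I : Input K d) (r : ℕ → Fin K → ℝ)

theorem gram_run_eq {n m : ℕ} (h : n ≤ m) (s : ℕ) :
    gram (playedContext I (run I r m)) ((run I r n).idx s)
      = gram (playedContext I (run I r n)) ((run I r n).idx s) := by
  refine gram_congr fun τ hτ => ?_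
  unfold playedContext
  rw [run_arm_eq I r (Finset.mem_Icc.1 (run_idx_subset I r n s hτ)).2 h]

/-- `2 ln det A` for the index set of stage `s` after round `n`. -/
noncomputable def stagePotential (n s : ℕ) : ℝ :=
  2 * Real.log (gram (playedContext I (run I r n)) ((run I r n).idx s)).det

/-- The sum of the potentials of all stages. -/
noncomputable def potential (n : ℕ) : ℝ :=
  ∑ s ∈ Finset.Icc 1 ⌊Real.log I.T⌋₊, stagePotential I r n s

variable {I r}

theorem invForm_le_stagePotential_sub (hx : ∀ t a, ‖I.x t a‖ ≤ 1) {n s : ℕ}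
    (hacc : ¬ Accurate I (run I r n) (n + 1) (finalStage I (run I r n) (n + 1)))
    (hs : s = finalStage I (run I r n) (n + 1)) (hsS : s ≤ ⌊Real.log I.T⌋₊) :
    invForm (playedContext I (run I r n)) ((run I r n).idx s)
        (I.x (n + 1) (chosenArm I (run I r n) (n + 1)))
      ≤ stagePotential I r (n + 1) s - stagePotential I r n s := by
  have hn : n + 1 ∉ (run I r n).idx s := fun h => by
    have := Finset.mem_Icc.1 (run_idx_subset I r n s h)
    omega
  have hidx : (run I r (n + 1)).idx s = insert (n + 1) ((run I r n).idx s) := by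
    ext τ
    rw [mem_run_idx_succ, Finset.mem_insert]
    tauto
  have h := invForm_le_log_det (playedContext I (run I r (n + 1))) _ hn (hx _ _)
  unfold stagePotential
  rw [hidx]
  rw [gram_run_eq I r (Nat.le_succ n)] at h
  refine le_trans (le_of_eq ?_) h
  unfold invForm
  rw [gram_run_eq I r (Nat.le_succ n)]
  simp only [playedContext, run_arm_succ]

theorem stagePotential_mono (hx : ∀ t a, ‖I.x t a‖ ≤ 1) (n s : ℕ) :
    stagePotential I r n s ≤ stagePotential I r (n + 1) s := by
  by_cases h : ¬ Accurate I (run I r n) (n + 1) (finalStage I (run I r n) (n + 1))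
      ∧ s = finalStage I (run I r n) (n + 1) ∧ s ≤ ⌊Real.log I.T⌋₊
  · have h1 := invForm_le_stagePotential_sub (r := r) hx h.1 h.2.1 h.2.2
    have h2 := invForm_nonneg (playedContext I (run I r n)) ((run I r n).idx s)
      (I.x (n + 1) (chosenArm I (run I r n) (n + 1)))
    linarith
  · have hidx : (run I r (n + 1)).idx s = (run I r n).idx s := by
      ext τ
      rw [mem_run_idx_succ]
      tauto
    unfold stagePotential
    rw [hidx, gram_run_eq I r (Nat.le_succ n)]

/-- No stage potential decreases, so one stage's growth is bounded by the total. A single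
Cauchy–Schwarz over all rounds then suffices, without splitting by stage. -/
theorem stagePotential_sub_le (hx : ∀ t a, ‖I.x t a‖ ≤ 1) (n : ℕ) {s : ℕ}
    (hs : s ∈ Finset.Icc 1 ⌊Real.log I.T⌋₊) :
    stagePotential I r (n + 1) s - stagePotential I r n s
      ≤ potential I r (n + 1) - potential I r n := by
  unfold potential
  rw [← Finset.sum_sub_distrib]
  exact Finset.single_le_sum
    (f := fun s => stagePotential I r (n + 1) s - stagePotential I r n s)
    (fun σ _ => sub_nonneg.2 (stagePotential_mono hx n σ)) hs

theorem potential_mono (hx : ∀ t a, ‖I.x t a‖ ≤ 1) (n : ℕ) :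
    potential I r n ≤ potential I r (n + 1) :=
  Finset.sum_le_sum fun s _ => stagePotential_mono hx n s

theorem potential_zero : potential I r 0 = 0 := by
  unfold potential stagePotential
  simp [run, gram]

theorem potential_le (hx : ∀ t a, ‖I.x t a‖ ≤ 1) (n : ℕ) :
    potential I r n ≤ ⌊Real.log I.T⌋₊ * (2 * (d * Real.log (d + n))) := by
  unfold potential
  refine (Finset.sum_le_card_nsmul _ _ (2 * (d * Real.log (d + n))) fun s _ => ?_).trans_eq ?_
  · unfold stagePotential
    have h1 := log_det_gram_le (playedContext I (run I r n)) ((run I r n).idx s) fun τ => hx _ _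
    have hc : ((run I r n).idx s).card ≤ n := by
      simpa using Finset.card_le_card (run_idx_subset I r n s)
    rcases Nat.eq_zero_or_pos d with hd | hd
    · subst hd
      simp
    have h2 : Real.log (d + ((run I r n).idx s).card) ≤ Real.log (d + n) := by
      refine Real.log_le_log (by positivity) ?_
      gcongr
    have h3 : (d : ℝ) * Real.log (d + ((run I r n).idx s).card) ≤ d * Real.log (d + n) := by
      gcongr
    linarith
  · simp

end Potential

/-! ### From coverage to the regret bound -/

section Regret

variable {K d : ℕ} [NeZero K] {I : Input K d} {θ : EuclideanSpace ℝ (Fin d)}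
  {r : ℕ → Fin K → ℝ}

theorem covers_of_not_deviates (hε : 0 < I.ε) (hε1 : I.ε ≤ 1) (hc : 0 ≤ confConst K I.T I.v I.δ)
    (hθ : ‖θ‖ ≤ 1) {n : ℕ}
    (h : ∀ s ∈ Finset.Icc 1 ⌊Real.log I.T⌋₊, ∀ a,
      ¬ Deviates I θ (confConst K I.T I.v I.δ) n s (I.x (n + 1) a) r) :
    Covers I θ (run I r n) (n + 1) := by
  intro s hs a
  set H := run I r n with hH
  set y := playedContext I H with hy
  set z := I.x (n + 1) a with hz
  have hdev : |estimate I.ε y H.payoff (H.idx s) z - ∑ τ ∈ H.idx s, beta y (H.idx s) z τ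
      * inner ℝ (y τ) θ| ≤ confConst K I.T I.v I.δ * level I.ε y (H.idx s) z := by
    rcases le_or_gt s ⌊Real.log I.T⌋₊ with hsS | hsS
    · exact not_lt.1 (h s (Finset.mem_Icc.2 ⟨hs, hsS⟩) a)
    -- Beyond stage `S` the index sets stay empty and both sums vanish, so only stages up to `S`
    -- enter the union bound.
    · rw [estimate_eq, hH, run_idx_eq_empty I r n hsS]
      simp only [Finset.sum_empty, sub_zero, abs_zero]
      exact mul_nonneg hc (level_nonneg _ _ _ _)
  have hbias := abs_inner_sub_sum_le y (H.idx s) z θ hθ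
  have hcard : ((H.idx s).card : ℝ) ≤ ((n + 1 : ℕ) : ℝ) := by
    have : (H.idx s).card ≤ n := by simpa using Finset.card_le_card (run_idx_subset I r n s)
    exact_mod_cast this.trans (Nat.le_succ n)
  have hlev := mul_le_mul_of_nonneg_left (level_le y (H.idx s) hε hε1 z hcard) hc
  have hw : stageWidth I H (n + 1) s a = confConst K I.T I.v I.δ
      * (((n + 1 : ℕ) : ℝ) ^ ((1 - I.ε) / (2 * (1 + I.ε))) * √(invForm y (H.idx s) z))
      + √(invForm y (H.idx s) z) := by
    unfold stageWidth width alpha invForm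
    ring
  rw [hw]
  rw [abs_le] at *
  constructor <;> linarith [hdev.1, hdev.2, hbias.1, hbias.2]

/-- An explored arm of final stage `s` has width above `2⁻ˢ`, so its gap is below eight widths. If
`s > S`, then `8 * 2⁻ˢ ≤ 4 * 2^{-S}` is used instead, as the potential does not grow. -/
theorem gap_le (hT : 0 < I.T) (hε : 0 < I.ε) (hε1 : I.ε ≤ 1)
    (hc : 0 ≤ confConst K I.T I.v I.δ) (hθ : ‖θ‖ ≤ 1) (hx : ∀ t a, ‖I.x t a‖ ≤ 1) {n : ℕ}
    (hn : n < I.T) (hcov : Covers I θ (run I r n) (n + 1)) {b : Fin K}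
    (hb : ∀ a, inner ℝ (I.x (n + 1) a) θ ≤ inner ℝ (I.x (n + 1) b) θ) :
    inner ℝ (I.x (n + 1) b) θ - inner ℝ (I.x (n + 1) (chosenArm I (run I r n) (n + 1))) θ
      ≤ 2 / √(I.T : ℝ) + 4 * (2 : ℝ) ^ (-(⌊Real.log I.T⌋₊ : ℤ))
        + 8 * ((alpha K I.T I.ε I.v I.δ I.T + 1) * √(potential I r (n + 1) - potential I r n)) := by
  have hexp : 0 ≤ (1 - I.ε) / (2 * (1 + I.ε)) := div_nonneg (by linarith) (by linarith)
  have hαT : 0 ≤ alpha K I.T I.ε I.v I.δ I.T :=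
    mul_nonneg hc (Real.rpow_nonneg (Nat.cast_nonneg _) _)
  by_cases hacc : Accurate I (run I r n) (n + 1) (finalStage I (run I r n) (n + 1))
  · have := hcov.gap_le_of_accurate hT hθ hx hb hacc
    have h2 : (0 : ℝ) ≤ 4 * (2 : ℝ) ^ (-(⌊Real.log I.T⌋₊ : ℤ)) := by positivity
    have h3 : 0 ≤ 8 * ((alpha K I.T I.ε I.v I.δ I.T + 1)
        * √(potential I r (n + 1) - potential I r n)) := by positivity
    linarith
  obtain ⟨hcand, hwide⟩ := Finset.mem_filter.1 (chosenArm_mem_wide hT hacc)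
  have hs1 := (finalStage_mem I hT (run I r n) (n + 1)).1
  have hgap := (hcov.candidates_spec hθ hx hb hs1 le_rfl).2 _ hcand
  have h0 : 0 ≤ 2 / √(I.T : ℝ) := by positivity
  rcases le_or_gt (finalStage I (run I r n) (n + 1)) ⌊Real.log I.T⌋₊ with hsS | hsS
  · have h1 := (invForm_le_stagePotential_sub hx hacc rfl hsS).trans
      (stagePotential_sub_le hx n (Finset.mem_Icc.2 ⟨hs1, hsS⟩))
    have h2 : stageWidth I (run I r n) (n + 1) (finalStage I (run I r n) (n + 1))
        (chosenArm I (run I r n) (n + 1)) ≤ (alpha K I.T I.ε I.v I.δ I.T + 1)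
          * √(potential I r (n + 1) - potential I r n) := by
      unfold stageWidth width
      refine mul_le_mul ?_ (Real.sqrt_le_sqrt h1) (Real.sqrt_nonneg _) (by linarith)
      unfold alpha
      gcongr
      exact hn
    have h3 : (0 : ℝ) ≤ 4 * (2 : ℝ) ^ (-(⌊Real.log I.T⌋₊ : ℤ)) := by positivity
    linarith
  · have h1 : (2 : ℝ) ^ (-(finalStage I (run I r n) (n + 1) : ℤ))
        ≤ (2 : ℝ) ^ (-(⌊Real.log I.T⌋₊ : ℤ) - 1) :=
      zpow_le_zpow_right₀ one_le_two (by omega)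
    rw [zpow_sub₀ two_ne_zero, zpow_one] at h1
    have h3 : 0 ≤ 8 * ((alpha K I.T I.ε I.v I.δ I.T + 1)
        * √(potential I r (n + 1) - potential I r n)) := by positivity
    linarith

theorem exists_regret_eq (I : Input K d) (θ : EuclideanSpace ℝ (Fin d)) (r : ℕ → Fin K → ℝ) :
    ∃ b : ℕ → Fin K, (∀ t a, inner ℝ (I.x t a) θ ≤ inner ℝ (I.x t (b t)) θ) ∧
      regret I θ r = ∑ n ∈ Finset.range I.T, (inner ℝ (I.x (n + 1) (b (n + 1))) θ
        - inner ℝ (I.x (n + 1) (chosenArm I (run I r n) (n + 1))) θ) := by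
  choose b hb using fun t => Finite.exists_max fun a => inner ℝ (I.x t a) θ
  refine ⟨b, hb, ?_⟩
  unfold regret
  have hshift := Finset.sum_Ico_add' (fun t => inner ℝ (I.x t (b t)) θ
    - inner ℝ (I.x t (chosenArm I (run I r (t - 1)) t)) θ) 0 I.T 1
  simp only [Nat.add_sub_cancel] at hshift
  rw [Finset.range_eq_Ico, hshift]
  refine Finset.sum_congr (by ext; simp) fun t ht => ?_
  have ht' := Finset.mem_Icc.1 ht
  obtain ⟨n, rfl⟩ : ∃ n, t = n + 1 := ⟨t - 1, by omega⟩
  rw [run_arm_eq I r le_rfl ht'.2, run_arm_succ]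
  congr 1
  exact le_antisymm (ciSup_le (hb _)) 
    (le_ciSup (f := fun a => inner ℝ (I.x (n + 1) a) θ) (Set.finite_range _).bddAbove (b (n + 1)))

theorem regret_le_of_covers (hT : 0 < I.T) (hε : 0 < I.ε) (hε1 : I.ε ≤ 1)
    (hc : 0 ≤ confConst K I.T I.v I.δ) (hθ : ‖θ‖ ≤ 1) (hx : ∀ t a, ‖I.x t a‖ ≤ 1)
    (hcov : ∀ n < I.T, Covers I θ (run I r n) (n + 1)) :
    regret I θ r ≤ 2 * √(I.T : ℝ) + I.T * (4 * (2 : ℝ) ^ (-(⌊Real.log I.T⌋₊ : ℤ)))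
      + 8 * ((alpha K I.T I.ε I.v I.δ I.T + 1)
        * √(I.T * (⌊Real.log I.T⌋₊ * (2 * (d * Real.log (d + I.T)))))) := by
  obtain ⟨b, hb, hreg⟩ := exists_regret_eq I θ r
  have hαT : 0 ≤ alpha K I.T I.ε I.v I.δ I.T :=
    mul_nonneg hc (Real.rpow_nonneg (Nat.cast_nonneg _) _)
  rw [hreg]
  refine (Finset.sum_le_sum fun n hn => gap_le hT hε hε1 hc hθ hx (Finset.mem_range.1 hn)
    (hcov n (Finset.mem_range.1 hn)) (hb (n + 1))).trans ?_
  rw [Finset.sum_add_distrib, Finset.sum_const, Finset.card_range, nsmul_eq_mul, ← Finset.mul_sum,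
    ← Finset.mul_sum, mul_add]
  have h1 : (I.T : ℝ) * (2 / √(I.T : ℝ)) = 2 * √(I.T : ℝ) := by
    rw [mul_div_left_comm, Real.div_sqrt]
  have h2 : ∑ n ∈ Finset.range I.T, √(potential I r (n + 1) - potential I r n)
      ≤ √(I.T * (⌊Real.log I.T⌋₊ * (2 * (d * Real.log (d + I.T))))) := by
    -- Cauchy–Schwarz; the increments telescope from `potential_zero`.
    refine Real.le_sqrt_of_sq_le (sq_sum_le_card_mul_sum_sq.trans ?_)
    rw [Finset.card_range, Finset.sum_congr rfl fun n _ =>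
      Real.sq_sqrt (sub_nonneg.2 (potential_mono hx n)), Finset.sum_range_sub, potential_zero,
      sub_zero]
    gcongr
    exact potential_le hx I.T
  rw [h1]
  gcongr

theorem regret_le_two_mul (hθ : ‖θ‖ ≤ 1) (hx : ∀ t a, ‖I.x t a‖ ≤ 1) :
    regret I θ r ≤ 2 * I.T := by
  obtain ⟨b, -, hreg⟩ := exists_regret_eq I θ r
  rw [hreg]
  refine (Finset.sum_le_card_nsmul _ _ 2 fun n _ => gap_le_two hθ hx _ _).trans_eq ?_
  simp [mul_comm]

theorem regret_of_dim_zero {I : Input K 0} {θ : EuclideanSpace ℝ (Fin 0)} : regret I θ r = 0 := by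
  obtain ⟨b, -, hreg⟩ := exists_regret_eq I θ r
  rw [hreg]
  refine Finset.sum_eq_zero fun n _ => ?_
  rw [Subsingleton.elim θ 0, inner_zero_right, inner_zero_right, sub_zero]

/-- `ln T ≤ S + 1` and `1/2 < ln 2`. -/
theorem sqrt_le_two_pow_floor_log {T : ℕ} (hT : 2 ≤ T) :
    √(T : ℝ) ≤ 2 * (2 : ℝ) ^ ⌊Real.log T⌋₊ := by
  have hT0 : (0 : ℝ) < T := by positivity
  have hl : 0 ≤ Real.log T := Real.log_natCast_nonneg T
  have h1 := (Nat.lt_floor_add_one (Real.log T)).le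
  have hl2 := Real.log_two_gt_d9
  calc √(T : ℝ) = Real.exp (Real.log T * (1 / 2)) := by
        rw [Real.sqrt_eq_rpow, Real.rpow_def_of_pos hT0]
    _ ≤ Real.exp ((⌊Real.log T⌋₊ + 1) * Real.log 2) := by
        rw [Real.exp_le_exp]
        gcongr
        linarith
    _ = 2 * (2 : ℝ) ^ ⌊Real.log T⌋₊ := by
        rw [mul_comm, ← Real.rpow_def_of_pos two_pos, Real.rpow_add two_pos, Real.rpow_natCast,
          Real.rpow_one, mul_comm]

theorem regret_bound (hT : 2 ≤ I.T) (hε : 0 < I.ε) (hε1 : I.ε ≤ 1)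
    (hc : 0 ≤ confConst K I.T I.v I.δ) (hθ : ‖θ‖ ≤ 1) (hx : ∀ t a, ‖I.x t a‖ ≤ 1)
    (hcov : ∀ n < I.T, Covers I θ (run I r n) (n + 1)) :
    regret I θ r ≤ 2 * √(I.T : ℝ) + 40 * Real.log I.T * √((d : ℝ) * I.T)
      + 40 * confConst K I.T I.v I.δ * Real.log I.T * √(d : ℝ) * (I.T : ℝ) ^ (1 / (1 + I.ε)) := by
  have hT0 : (0 : ℝ) < I.T := by positivity
  have hT2 : (2 : ℝ) ≤ I.T := by exact_mod_cast hT
  have hlog : 0.69 ≤ Real.log I.T :=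
    (by linarith [Real.log_two_gt_d9] : 0.69 ≤ Real.log 2).trans (Real.log_le_log two_pos hT2)
  have hsT : 0 ≤ √(I.T : ℝ) := Real.sqrt_nonneg _
  have hlast : 0 ≤ 40 * confConst K I.T I.v I.δ * Real.log I.T * √(d : ℝ)
      * (I.T : ℝ) ^ (1 / (1 + I.ε)) := by positivity
  rcases Nat.eq_zero_or_pos d with rfl | hd
  · rw [regret_of_dim_zero]
    positivity
  have hd1 : (1 : ℝ) ≤ d := by exact_mod_cast hd
  -- For `d ≥ T` the trivial bound `2 T ≤ 2 √(d T)` is enough; otherwise `d + T ≤ T ^ 2` controls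
  -- the logarithm.
  rcases le_or_gt I.T d with hdT | hdT
  · refine (regret_le_two_mul hθ hx).trans ?_
    have hdT' : (I.T : ℝ) ≤ d := by exact_mod_cast hdT
    have h1 : (I.T : ℝ) ≤ √((d : ℝ) * I.T) := Real.le_sqrt_of_sq_le (by nlinarith)
    nlinarith
  refine (regret_le_of_covers (by omega) hε hε1 hc hθ hx hcov).trans ?_
  have hdT' : (d : ℝ) ≤ I.T := by exact_mod_cast hdT.le
  have hsq : √((d : ℝ) * I.T) = √(d : ℝ) * √(I.T : ℝ) := Real.sqrt_mul (by positivity) _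
  have hsd : 1 ≤ √(d : ℝ) := Real.one_le_sqrt.2 hd1
  -- The left side is at most `8 √T`, and `24 * 0.69 ≥ 8`. The `24` is what the `16` of `h4` leaves
  -- of `40`.
  have h1 : (I.T : ℝ) * (4 * (2 : ℝ) ^ (-(⌊Real.log I.T⌋₊ : ℤ)))
      ≤ 24 * Real.log I.T * √((d : ℝ) * I.T) := by
    have h2 := sqrt_le_two_pow_floor_log hT
    have h3 : (I.T : ℝ) * (4 * (2 : ℝ) ^ (-(⌊Real.log I.T⌋₊ : ℤ))) ≤ 8 * √(I.T : ℝ) := by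
      rw [zpow_neg, zpow_natCast, ← mul_assoc, mul_inv_le_iff₀ (by positivity)]
      nlinarith [Real.mul_self_sqrt hT0.le]
    have h4 : √(I.T : ℝ) ≤ √(d : ℝ) * √(I.T : ℝ) := le_mul_of_one_le_left hsT hsd
    rw [hsq]
    nlinarith
  have h2 : √(I.T * (⌊Real.log I.T⌋₊ * (2 * (d * Real.log (d + I.T)))))
      ≤ 2 * Real.log I.T * √((d : ℝ) * I.T) := by
    refine Real.sqrt_le_iff.2 ⟨by positivity, ?_⟩
    have h3 : (⌊Real.log I.T⌋₊ : ℝ) ≤ Real.log I.T := Nat.floor_le (by linarith)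
    have h4 : Real.log (d + I.T) ≤ 2 * Real.log I.T := by
      rw [← Real.log_rpow hT0]
      refine Real.log_le_log (by positivity) ?_
      norm_num
      nlinarith
    have h5 : 0 ≤ Real.log (d + I.T) := Real.log_nonneg (by linarith)
    rw [mul_pow, Real.sq_sqrt (by positivity)]
    calc (I.T : ℝ) * (⌊Real.log I.T⌋₊ * (2 * (d * Real.log (d + I.T))))
        ≤ I.T * (Real.log I.T * (2 * (d * (2 * Real.log I.T)))) := by gcongr
      _ = _ := by ring
  -- The exponents add up: `(1 - ε) / (2 (1 + ε)) + 1/2 = 1 / (1 + ε)`.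
  have h3 : alpha K I.T I.ε I.v I.δ I.T * √(I.T : ℝ)
      = confConst K I.T I.v I.δ * (I.T : ℝ) ^ (1 / (1 + I.ε)) := by
    unfold alpha
    rw [mul_assoc, Real.sqrt_eq_rpow, ← Real.rpow_add hT0]
    congr 2
    field_simp
    ring
  have hαT : 0 ≤ alpha K I.T I.ε I.v I.δ I.T :=
    mul_nonneg hc (Real.rpow_nonneg (Nat.cast_nonneg _) _)
  have h4 : 8 * ((alpha K I.T I.ε I.v I.δ I.T + 1)
        * √(I.T * (⌊Real.log I.T⌋₊ * (2 * (d * Real.log (d + I.T))))))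
      ≤ 16 * Real.log I.T * √((d : ℝ) * I.T)
        + 16 * confConst K I.T I.v I.δ * Real.log I.T * √(d : ℝ) * (I.T : ℝ) ^ (1 / (1 + I.ε)) := by
    calc _ ≤ 8 * ((alpha K I.T I.ε I.v I.δ I.T + 1) * (2 * Real.log I.T * √((d : ℝ) * I.T))) := by
          gcongr
      _ = 16 * Real.log I.T * √((d : ℝ) * I.T)
          + 16 * (alpha K I.T I.ε I.v I.δ I.T * √(I.T : ℝ)) * Real.log I.T * √(d : ℝ) := by
          rw [hsq]; ring
      _ = _ := by rw [h3]; ring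
  linarith

end Regret

end SupBTC

/-! ### Union bound over rounds, stages and arms -/

theorem theorem2 {Ω : Type*} [MeasurableSpace Ω] (μ : Measure Ω) [IsProbabilityMeasure μ]
    (K d T : ℕ) [NeZero K] (hT : 2 ≤ T)
    (ε v δ : ℝ) (hε : 0 < ε) (hε1 : ε ≤ 1) (hv : 0 < v) (hδ : 0 < δ) (hδ1 : δ < 1)
    (θ : EuclideanSpace ℝ (Fin d)) (hθ : ‖θ‖ ≤ 1)
    (x : ℕ → Fin K → EuclideanSpace ℝ (Fin d)) (hx : ∀ t a, ‖x t a‖ ≤ 1)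
    (r : ℕ → Fin K → Ω → ℝ) (hmeas : ∀ t a, Measurable (r t a))
    (hindep : iIndepFun (fun (t : ℕ) (ω : Ω) (a : Fin K) => r t a ω) μ)
    (hint : ∀ t a, Integrable (fun ω => |r t a ω| ^ (1 + ε)) μ)
    (hmom : ∀ t a, ∫ ω, |r t a ω| ^ (1 + ε) ∂μ ≤ v)
    (hmean : ∀ t a, ∫ ω, r t a ω ∂μ = inner ℝ (x t a) θ)
    (rule : SupBTC.ChoiceRule K) :
    1 - δ ≤ μ.real {ω |
      SupBTC.regret { T := T, ε := ε, v := v, δ := δ, x := x, rule := rule } θ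
          (fun t a => r t a ω)
        ≤ 2 * √(T : ℝ) + 40 * Real.log T * √((d : ℝ) * T)
          + 40 * (2 / 3 * Real.log (2 * T * K * Real.log T / δ)
              + √(2 * Real.log (2 * T * K * Real.log T / δ) * v) + v)
            * Real.log T * √(d : ℝ) * (T : ℝ) ^ (1 / (1 + ε))} := by
  set I : SupBTC.Input K d := { T := T, ε := ε, v := v, δ := δ, x := x, rule := rule } with hI
  have hT2 : (2 : ℝ) ≤ T := by exact_mod_cast hT
  have hK1 : (1 : ℝ) ≤ K := by exact_mod_cast NeZero.one_le
  have hlog : 0.69 ≤ Real.log T :=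
    (by linarith [Real.log_two_gt_d9] : 0.69 ≤ Real.log 2).trans (Real.log_le_log two_pos hT2)
  set L := Real.log (2 * T * K * Real.log T / δ) with hL
  -- `L` is positive already for `T = 2`, `K = 1`, because `4 * 0.69 > 1 > δ`.
  have harg : 1 < 2 * T * K * Real.log T / δ := by
    rw [lt_div_iff₀ hδ, one_mul]
    have h1 : (4 : ℝ) * 1 * 0.69 ≤ 2 * T * K * Real.log T := by gcongr; linarith
    linarith
  have hL0 : 0 < L := Real.log_pos harg
  have hexp : 2 * Real.exp (-L) = δ / (T * K * Real.log T) := by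
    rw [Real.exp_neg, hL, Real.exp_log (by linarith)]
    field_simp
  have hc : 0 ≤ SupBTC.confConst K I.T I.v I.δ := by
    change 0 ≤ 2 / 3 * L + √(2 * L * v) + v
    positivity
  set S := ⌊Real.log T⌋₊ with hS
  let bad : ℕ × ℕ × Fin K → Set Ω := fun i =>
    {ω | SupBTC.Deviates I θ (2 / 3 * L + √(2 * L * v) + v) i.1 i.2.1 (x (i.1 + 1) i.2.2)
      fun t a => r t a ω}
  let J : Finset (ℕ × ℕ × Fin K) := Finset.range T ×ˢ Finset.Icc 1 S ×ˢ Finset.univ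
  have hbad : ∀ i, μ.real (bad i) ≤ δ / (T * K * Real.log T) := fun i => by
    rw [← hexp]
    refine ENNReal.toReal_le_of_le_ofReal (by positivity) ?_
    exact SupBTC.measure_deviates_le I (by simp only [hI]; omega) hε hε1 hv hL0 θ hmeas hindep hint
      hmom hmean _ _ _
  have hunion : μ.real (⋃ i ∈ J, bad i) ≤ δ := by
    refine (measureReal_biUnion_finset_le J bad).trans
      ((Finset.sum_le_card_nsmul _ _ _ fun i _ => hbad i).trans ?_)
    have hSl : (S : ℝ) ≤ Real.log T := Nat.floor_le (by linarith)
    have hJ : (J.card : ℝ) = T * S * K := by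
      simp [J, mul_assoc]
    rw [nsmul_eq_mul, hJ]
    calc (T : ℝ) * S * K * (δ / (T * K * Real.log T))
        ≤ T * Real.log T * K * (δ / (T * K * Real.log T)) := by gcongr
      _ = δ := by field_simp
  -- Covering the whole space and using subadditivity avoids measurability of the regret event.
  have hcover : (Set.univ : Set Ω) ⊆ {ω | SupBTC.regret I θ (fun t a => r t a ω)
        ≤ 2 * √(T : ℝ) + 40 * Real.log T * √((d : ℝ) * T)
          + 40 * (2 / 3 * L + √(2 * L * v) + v)
            * Real.log T * √(d : ℝ) * (T : ℝ) ^ (1 / (1 + ε))} ∪ ⋃ i ∈ J, bad i := by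
    intro ω _
    by_cases hω : ω ∈ ⋃ i ∈ J, bad i
    · exact .inr hω
    · refine .inl (SupBTC.regret_bound (I := I) hT hε hε1 hc hθ hx fun n hn => ?_)
      refine SupBTC.covers_of_not_deviates hε hε1 hc hθ fun s hs a hdev => hω ?_
      exact Set.mem_biUnion (x := (n, s, a)) (by
        simp only [J, Finset.coe_product, Set.mem_prod, Finset.mem_coe, Finset.mem_range,
          Finset.mem_univ, and_true]
        exact ⟨hn, hs⟩) hdev
  have h1 := (measureReal_mono hcover (measure_ne_top μ _)).trans (measureReal_union_le _ _)
  rw [probReal_univ] at h1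
  linarith
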